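/- Let $n,r\ge 1$ be integers with $\max\{n,r\}>1$, let $a>0$ and $\tau_1,\dots,\tau_n>0$, put $P(t)=a\prod_{k=1}^n(\tau_k-t)$, and define polynomials $H_m(z)\in\mathbb{R}[z]$ by $$\sum_{m\ge 0}H_m(z)t^m=\frac{1}{P(t)+zt^r}.$$ For $\theta\in(0,\pi/r)$ let $\theta_1,\dots,\theta_n\in(\theta,\pi)$ be the unique angles with $\sum_{k}\theta_k=r\theta+(n-1)\pi$ for which the numbers $\tau_k\sin\theta_k/\sin(\theta_k-\theta)$ have a common value $\tau(\theta)$; put $t_0=\tau(\theta)e^{-i\theta}$, $z(\theta)=-P(t_0)/t_0^r$, and $$Q_\theta(\zeta)=\prod_{j=1}^n\left(\frac{\sin(\theta_j-\theta)}{\sin\theta}-\zeta\,\frac{\sin\theta_j}{\sin\theta}\right)+\zeta^r .$$ For $m\ge0$, let $H(\theta)=H(\theta;m)$ be the real part of $$\lim_{\theta'\to\theta,\ \theta'\ne\theta}\ \sum_{\zeta:\,Q_{\theta'}(\zeta)=0}\frac{1}{\zeta^{m+1}Q_{\theta'}'(\zeta)},$$ the sum being over the complex zeros of $Q_{\theta'}$.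 Then: 1. $z(\theta)$ is real for every $\theta\in(0,\pi/r)$. For every $m$, $H$ is continuous on $(0,\pi/r)$; it equals the sum $\sum_{\zeta:\,Q_\theta(\zeta)=0}1/(\zeta^{m+1}Q_\theta'(\zeta))$ at each $\theta\in(0,\pi/r)$ for which $Q_\theta$ has distinct zeros (so this sum is real there); and, for $\theta\in(0,\pi/r)$, $H(\theta)=0$ if and only if $H_m(z(\theta))=0$. 2. If $(n,r)\neq(2,1)$, then for all sufficiently large $m$ and all $h=1,\dots,\lfloor m/r\rfloor$, $\operatorname{sgn}H\!\left(\frac{h\pi}{m+r}\right)=(-1)^h$. 3. For all sufficiently large $m$, $\operatorname{sgn}H(\theta)=(-1)^{\lfloor m/r\rfloor+1}$ for all $\theta<\pi/r$ sufficiently close to $\pi/r$ (depending on $m$). 4. $\deg H_m\le\lfloor m/r\rfloor$ for every $m$, and for all sufficiently large $m$ all complex zeros of $H_m$ are real. Here "sufficiently large" depends only on $P$ and $r$. -/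

import Mathlib

open Polynomial Filter Topology Real

/-- The real polynomial `P(t) = a ∏ₖ (τₖ - t)`, with positive zeros `τₖ` repeated according to
multiplicity. -/
noncomputable def rootPoly {n : ℕ} (a : ℝ) (τ : Fin n → ℝ) : ℝ[X] :=
  C a * ∏ k, (C (τ k) - X)

/-- The denominator `P(t) + z t ^ r`, as a power series in `t` with coefficients in `ℝ[z]`. -/
noncomputable def denomSeries {n : ℕ} (a : ℝ) (τ : Fin n → ℝ) (r : ℕ) : PowerSeries ℝ[X] :=
  (((rootPoly a τ).map C : ℝ[X][X]) : PowerSeries ℝ[X]) +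
    PowerSeries.C (X : ℝ[X]) * PowerSeries.X ^ r

/-- The polynomial `H_m(z)`: the coefficient of `t ^ m` in `1 / (P(t) + z t ^ r)`. -/
noncomputable def genPoly {n : ℕ} (a : ℝ) (τ : Fin n → ℝ) (r m : ℕ) : ℝ[X] :=
  PowerSeries.coeff m (Ring.inverse (denomSeries a τ r))

/-- The inverse that defines `H_m` is a genuine one: `(P(t) + z t ^ r) ∑ H_m(z) t ^ m = 1`. -/
theorem denomSeries_mul_mk_genPoly {n : ℕ} {a : ℝ} (ha : 0 < a) {τ : Fin n → ℝ}
    (hτ : ∀ k, 0 < τ k) {r : ℕ} (hr : 1 ≤ r) :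
    denomSeries a τ r * PowerSeries.mk (genPoly a τ r) = 1 := by
  have h1 : PowerSeries.mk (genPoly a τ r) = Ring.inverse (denomSeries a τ r) := by
    ext m : 1
    simp [genPoly]
  rw [h1]
  apply Ring.mul_inverse_cancel
  rw [PowerSeries.isUnit_iff_constantCoeff]
  have h2 : PowerSeries.constantCoeff (denomSeries a τ r) = C (a * ∏ k, τ k) := by
    have : r ≠ 0 := by omega
    simp [denomSeries, rootPoly, this, Polynomial.coeff_zero_eq_eval_zero,
      Polynomial.eval_prod, Polynomial.map_prod]
  rw [h2]
  exact Polynomial.isUnit_C.2 (isUnit_iff_ne_zero.2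
    (mul_pos ha (Finset.prod_pos fun k _ => hτ k)).ne')

/-- `ϑ = (θ₁, …, θₙ)` is the tuple of angles attached to `θ` (for the value `l = n - 1` of the
winding parameter), and `s = τ(θ)` is the common value of `τₖ sin θₖ / sin (θₖ - θ)`. -/
structure IsAngleTuple {n : ℕ} (τ : Fin n → ℝ) (r : ℕ) (θ : ℝ) (ϑ : Fin n → ℝ) (s : ℝ) : Prop where
  lower : ∀ k, θ < ϑ k
  upper : ∀ k, ϑ k < π
  sum_eq : ∑ k, ϑ k = r * θ + ((n : ℝ) - 1) * π
  ratio : ∀ k, τ k * (sin (ϑ k) / sin (ϑ k - θ)) = s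

/-- The angle seen from the law of sines as a function of the modulus `s`. -/
noncomputable def angleOf (t θ s : ℝ) : ℝ := π / 2 - arctan ((s * cos θ - t) / (s * sin θ))

theorem angleOf_spec {t θ s : ℝ} (ht : 0 < t) (h0 : 0 < θ) (h1 : θ < π) (hs : 0 < s) :
    θ < angleOf t θ s ∧ angleOf t θ s < π ∧
      t * (sin (angleOf t θ s) / sin (angleOf t θ s - θ)) = s := by
  have hS : 0 < sin θ := sin_pos_of_pos_of_lt_pi h0 h1
  set x := (s * cos θ - t) / (s * sin θ) with hx
  have hc : 0 < cos (arctan x) := cos_arctan_pos x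
  have hsx : sin (arctan x) = x * cos (arctan x) := by
    have := tan_arctan x
    rw [tan_eq_sin_div_cos, div_eq_iff hc.ne'] at this
    exact this
  have hl := neg_pi_div_two_lt_arctan x
  have hu := arctan_lt_pi_div_two x
  have e1 : sin (angleOf t θ s) = cos (arctan x) := by
    rw [angleOf, ← hx, sin_pi_div_two_sub]
  have e2 : sin (angleOf t θ s - θ) = cos (arctan x) * t / s := by
    rw [sin_sub, e1, angleOf, ← hx, cos_pi_div_two_sub, hsx, hx]
    field_simp
    ring
  have hpos : 0 < sin (angleOf t θ s - θ) := by rw [e2]; positivity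
  refine ⟨?_, ?_, ?_⟩
  · by_contra hcon
    have h2 : 0 < angleOf t θ s := by rw [angleOf, ← hx]; linarith
    exact absurd hpos (not_lt.2 (sin_nonpos_of_nonpos_of_neg_pi_le (by linarith) (by linarith)))
  · rw [angleOf, ← hx]; linarith
  · rw [e1, e2]
    field_simp

theorem eq_angleOf {t θ s φ : ℝ} (ht : 0 < t) (h0 : 0 < θ) (hl : θ < φ) (hu : φ < π)
    (h : t * (sin φ / sin (φ - θ)) = s) : 0 < s ∧ φ = angleOf t θ s := by
  have hS : 0 < sin θ := sin_pos_of_pos_of_lt_pi h0 (by linarith)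
  have hφ : 0 < sin φ := sin_pos_of_pos_of_lt_pi (by linarith) hu
  have hd : 0 < sin (φ - θ) := sin_pos_of_pos_of_lt_pi (by linarith) (by linarith)
  have hs : 0 < s := by rw [← h]; positivity
  refine ⟨hs, ?_⟩
  have key : s * (sin φ * cos θ - cos φ * sin θ) = t * sin φ := by
    rw [← sin_sub, ← h]
    field_simp
  have hx : (s * cos θ - t) / (s * sin θ) = tan (π / 2 - φ) := by
    rw [tan_eq_sin_div_cos, sin_pi_div_two_sub, cos_pi_div_two_sub, div_eq_div_iff (by positivity)
      hφ.ne']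
    linarith
  rw [angleOf, hx, arctan_tan (by linarith) (by linarith)]
  ring

theorem angleOf_lt {t θ s s' : ℝ} (ht : 0 < t) (h0 : 0 < θ) (h1 : θ < π) (hs : 0 < s)
    (hss : s < s') : angleOf t θ s' < angleOf t θ s := by
  have hS : 0 < sin θ := sin_pos_of_pos_of_lt_pi h0 h1
  have hs' : 0 < s' := hs.trans hss
  have : (s * cos θ - t) / (s * sin θ) < (s' * cos θ - t) / (s' * sin θ) := by
    rw [div_lt_div_iff₀ (by positivity) (by positivity)]
    nlinarith [mul_pos (mul_pos ht hS) (sub_pos.2 hss)]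
  have := arctan_strictMono this
  rw [angleOf, angleOf]
  linarith

theorem angleOf_eq {t θ s : ℝ} (h0 : 0 < θ) (h1 : θ < π) (hs : 0 < s) :
    angleOf t θ s = π / 2 - arctan (cos θ / sin θ - t / sin θ * s⁻¹) := by
  have hS : 0 < sin θ := sin_pos_of_pos_of_lt_pi h0 h1
  rw [angleOf]
  congr 2
  field_simp

/-- Existence and uniqueness of the angles `θₖ(θ)` and of the modulus `τ(θ)`. -/
theorem existsUnique_isAngleTuple {n r : ℕ} (hn : 1 ≤ n) (hr : 1 ≤ r) (hnr : 1 < max n r)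
    {τ : Fin n → ℝ} (hτ : ∀ k, 0 < τ k) {θ : ℝ} (hθ : θ ∈ Set.Ioo 0 (π / r)) :
    ∃! p : (Fin n → ℝ) × ℝ, IsAngleTuple τ r θ p.1 p.2 := by
  have hr' : (1 : ℝ) ≤ r := by exact_mod_cast hr
  have hn' : (1 : ℝ) ≤ n := by exact_mod_cast hn
  have h0 : 0 < θ := hθ.1
  have hrθ : r * θ < π := by
    have := (lt_div_iff₀ (by linarith : (0 : ℝ) < r)).1 hθ.2
    linarith
  have h1 : θ < π := by nlinarith
  have hS : 0 < sin θ := sin_pos_of_pos_of_lt_pi h0 h1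
  have hlim1 : ∀ k, Tendsto (angleOf (τ k) θ) atTop (𝓝 θ) := fun k => by
    have h2 : Tendsto (fun s : ℝ => cos θ / sin θ - τ k / sin θ * s⁻¹) atTop
        (𝓝 (cos θ / sin θ - τ k / sin θ * 0)) :=
      tendsto_const_nhds.sub (tendsto_inv_atTop_zero.const_mul _)
    have h3 := ((continuous_arctan.tendsto _).comp h2).const_sub (π / 2)
    have h4 : π / 2 - arctan (cos θ / sin θ - τ k / sin θ * 0) = θ := by
      have : cos θ / sin θ = tan (π / 2 - θ) := by
        rw [tan_eq_sin_div_cos, sin_pi_div_two_sub, cos_pi_div_two_sub]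
      rw [mul_zero, sub_zero, this, arctan_tan (by linarith) (by linarith)]
      ring
    rw [h4] at h3
    refine h3.congr' ?_
    filter_upwards [eventually_gt_atTop 0] with s hs
    rw [angleOf_eq h0 h1 hs]
    rfl
  have hlim2 : ∀ k, Tendsto (angleOf (τ k) θ) (𝓝[>] 0) (𝓝 π) := fun k => by
    have h2 : Tendsto (fun s : ℝ => cos θ / sin θ - τ k / sin θ * s⁻¹) (𝓝[>] 0) atBot := by
      have h5 : Tendsto (fun s : ℝ => τ k / sin θ * s⁻¹) (𝓝[>] 0) atTop :=
        tendsto_inv_nhdsGT_zero.const_mul_atTop (div_pos (hτ k) hS)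
      simp only [sub_eq_add_neg]
      exact tendsto_atBot_add_const_left _ _ (tendsto_neg_atTop_atBot.comp h5)
    have h3 := ((tendsto_arctan_atBot.mono_right nhdsWithin_le_nhds).comp h2).const_sub (π / 2)
    have h4 : π / 2 - -(π / 2) = π := by ring
    rw [h4] at h3
    refine h3.congr' ?_
    filter_upwards [self_mem_nhdsWithin] with s hs
    rw [angleOf_eq h0 h1 hs]
    rfl
  have hcont : ContinuousOn (fun s => ∑ k, angleOf (τ k) θ s) (Set.Ioi 0) := by
    refine continuousOn_finsetSum _ fun k _ => ?_
    refine continuousOn_const.sub (continuous_arctan.comp_continuousOn ?_)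
    refine ContinuousOn.div (by fun_prop) (by fun_prop) fun s hs => ?_
    exact (mul_pos hs hS).ne'
  have hl1 : Tendsto (fun s => ∑ k, angleOf (τ k) θ s) atTop (𝓝 (n * θ)) := by
    simpa using tendsto_finsetSum Finset.univ fun k _ => hlim1 k
  have hl2 : Tendsto (fun s => ∑ k, angleOf (τ k) θ s) (𝓝[>] 0) (𝓝 (n * π)) := by
    simpa using tendsto_finsetSum Finset.univ fun k _ => hlim2 k
  have hmem : (r * θ + ((n : ℝ) - 1) * π) ∈ Set.Ioo (n * θ) (n * π) := by
    constructor
    · rcases lt_max_iff.1 hnr with h | h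
      · have : (1 : ℝ) < n := by exact_mod_cast h
        nlinarith [mul_pos (sub_pos.2 this) (sub_pos.2 h1)]
      · have : (1 : ℝ) < r := by exact_mod_cast h
        nlinarith [mul_pos (sub_pos.2 this) h0, mul_nonneg (sub_nonneg.2 hn') (sub_pos.2 h1).le]
    · linarith
  obtain ⟨s, hs, hsum⟩ := isPreconnected_Ioi.intermediate_value_Ioo
    (le_principal_iff.2 (Ioi_mem_atTop 0)) (le_principal_iff.2 self_mem_nhdsWithin)
    hcont hl1 hl2 hmem
  have hs : 0 < s := hs
  refine ⟨(fun k => angleOf (τ k) θ s, s), ⟨fun k => (angleOf_spec (hτ k) h0 h1 hs).1,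
    fun k => (angleOf_spec (hτ k) h0 h1 hs).2.1, hsum,
    fun k => (angleOf_spec (hτ k) h0 h1 hs).2.2⟩, ?_⟩
  rintro ⟨ϑ, s'⟩ h
  have key : ∀ k, 0 < s' ∧ ϑ k = angleOf (τ k) θ s' := fun k =>
    eq_angleOf (hτ k) h0 (h.lower k) (h.upper k) (h.ratio k)
  have hs' : 0 < s' := (key ⟨0, hn⟩).1
  have hsum' : ∑ k, angleOf (τ k) θ s' = r * θ + ((n : ℝ) - 1) * π := by
    rw [← h.sum_eq]
    exact Finset.sum_congr rfl fun k _ => (key k).2.symm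
  have hne : (Finset.univ : Finset (Fin n)).Nonempty := ⟨⟨0, hn⟩, Finset.mem_univ _⟩
  have hss : s' = s := by
    rcases lt_trichotomy s' s with hlt | heq | hgt
    · have := Finset.sum_lt_sum_of_nonempty hne fun k _ => angleOf_lt (hτ k) h0 h1 hs' hlt
      simp only at hsum
      linarith
    · exact heq
    · have := Finset.sum_lt_sum_of_nonempty hne fun k _ => angleOf_lt (hτ k) h0 h1 hs hgt
      simp only at hsum
      linarith
  subst hss
  exact Prod.ext (funext fun k => (key k).2) rfl

/-- The pair formed by the angles `(θ₁(θ), …, θₙ(θ))` and the modulus `τ(θ)`. -/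
noncomputable def angleData {n : ℕ} (τ : Fin n → ℝ) (r : ℕ) (θ : ℝ) : (Fin n → ℝ) × ℝ :=
  Classical.epsilon fun p => IsAngleTuple τ r θ p.1 p.2

/-- The angles `θₖ(θ)`. -/
noncomputable def angles {n : ℕ} (τ : Fin n → ℝ) (r : ℕ) (θ : ℝ) : Fin n → ℝ :=
  (angleData τ r θ).1

/-- The modulus `τ(θ)`. -/
noncomputable def modulus {n : ℕ} (τ : Fin n → ℝ) (r : ℕ) (θ : ℝ) : ℝ :=
  (angleData τ r θ).2

theorem isAngleTuple_angles {n r : ℕ} (hn : 1 ≤ n) (hr : 1 ≤ r) (hnr : 1 < max n r)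
    {τ : Fin n → ℝ} (hτ : ∀ k, 0 < τ k) {θ : ℝ} (hθ : θ ∈ Set.Ioo 0 (π / r)) :
    IsAngleTuple τ r θ (angles τ r θ) (modulus τ r θ) :=
  Classical.epsilon_spec (existsUnique_isAngleTuple hn hr hnr hτ hθ).exists

/-- The zero `t₀ = τ(θ) e ^ (-iθ)`. -/
noncomputable def tZero {n : ℕ} (τ : Fin n → ℝ) (r : ℕ) (θ : ℝ) : ℂ :=
  modulus τ r θ * Complex.exp (-(θ * Complex.I))

/-- `z(θ) = -P(t₀) / t₀ ^ r`, a priori a complex number. -/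
noncomputable def zFun {n : ℕ} (a : ℝ) (τ : Fin n → ℝ) (r : ℕ) (θ : ℝ) : ℂ :=
  -(aeval (tZero τ r θ) (rootPoly a τ)) / tZero τ r θ ^ r

/-- The polynomial `Q(ζ) = ∏ⱼ (sin (θⱼ - θ) / sin θ - ζ sin θⱼ / sin θ) + ζ ^ r`. -/
noncomputable def qPoly {n : ℕ} (τ : Fin n → ℝ) (r : ℕ) (θ : ℝ) : ℝ[X] :=
  ∏ j, (C (sin (angles τ r θ j - θ) / sin θ) - C (sin (angles τ r θ j) / sin θ) * X) + X ^ r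

/-- The sum `∑ₖ 1 / (ζₖ ^ (m + 1) Q'(ζₖ))` over the complex zeros of `Q`; meaningful where these
zeros are distinct. -/
noncomputable def hSum {n : ℕ} (τ : Fin n → ℝ) (r m : ℕ) (θ : ℝ) : ℂ :=
  (((qPoly τ r θ).aroots ℂ).map fun ζ =>
    1 / (ζ ^ (m + 1) * aeval ζ (derivative (qPoly τ r θ)))).sum

/-- The real function `H(θ)` (for the index `m`): the limit of the sum `hSum` along punctured
neighbourhoods, that is, the sum with its removable discontinuities removed. -/
noncomputable def hFun {n : ℕ} (τ : Fin n → ℝ) (r m : ℕ) (θ : ℝ) : ℝ :=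
  (limUnder (𝓝[≠] θ) (hSum τ r m)).re

/-! For fixed z > 0 the numbers H_m(z) are the output of a linear flow on a cycle. Each factor τⱼ -
t of P acts as a first-order filter, the term z t^r acts as a delay line, and the equation (P + z
t^r) ∑ H_m t^m = 1 closes the cycle with a negative feedback (`genFlow_cyclicFlow`). The flow is
variation diminishing: every state, read along the cycle up to the feedback value, changes sign at
most once (`CyclicFlow.singleCut`).

The zero t = τ(θ)e^{iθ} of the denominator provides a left eigenvector, whose pairing with the state
at time m is t^{-(m+1)}/a. Its weights have nondecreasing arguments of total spread less than π. If
(m + r + κ)θ = hπ with 0 ≤ κ < 1, then up to the factor (-1)^h the pairing points κθ beyond the last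
weight. A state with a single sign change can reach this direction only if (-1)^h H_m(z(θ)) < 0
(`CyclicFlow.neg_of_pairing`, `CyclicFlow.sign`); for κ = 0 this needs (n, r) ≠ (2, 1).

On the other side, Q is the denominator rescaled by τ(θ) and divided by a constant. Partial
fractions of -1/Q then give H(θ) = -z(θ) τ(θ)^{m+r} H_m(z(θ)) wherever Q has distinct zeros. This
covers all but finitely many θ, because z(θ) is injective and a multiple zero forces z(θ) to be a
critical value of -P(t)/t^r.

Taking κ = 0 gives the signs at hπ/(m + r). Taking κ = 1/2 gives ⌊m/r⌋ + 1 points of (0, π/r) with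
alternating signs, hence ⌊m/r⌋ distinct real zeros z(θ) of H_m. Since deg H_m ≤ ⌊m/r⌋, these are all
the zeros, and no sign change is left to the right of the last point. -/

/-- The first `N` values of `f` change sign at most once, in the weak sense. -/
def SingleCut (N : ℕ) (f : ℕ → ℝ) : Prop :=
  ∃ ε : ℝ, (ε = 1 ∨ ε = -1) ∧ ∃ p : ℕ,
    (∀ i < p, i < N → 0 ≤ ε * f i) ∧ ∀ i, p ≤ i → i < N → ε * f i ≤ 0

/-- A positive linear flow on a cycle of `n + r` cells closed by a negative feedback:
`n` first-order filters followed by a delay line of length `r`. -/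
structure CyclicFlow (n r : ℕ) (τ : ℕ → ℝ) (w : ℝ) (x : ℕ → ℕ → ℝ) : Prop where
  filter : ∀ m i, i < n → τ i * x (m + 1) i = x m i + x (m + 1) (i + 1)
  delay : ∀ m i, n ≤ i → i < n + r → x (m + 1) i = x m (i + 1)
  feedback : ∀ m, x m (n + r) = -w * x m 0
  init_pos : ∀ i < n, 0 < x 0 i
  init_zero : ∀ i, n ≤ i → i < n + r → x 0 i = 0

/-! ### Operations on finite lists that preserve having at most one sign change. -/

namespace SingleCut

variable {N : ℕ} {f g : ℕ → ℝ}

theorem congr (h : SingleCut N f) (hfg : ∀ i < N, g i = f i) : SingleCut N g := by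
  obtain ⟨ε, hε, p, h1, h2⟩ := h
  refine ⟨ε, hε, p, fun i hi hN => ?_, fun i hi hN => ?_⟩
  · rw [hfg i hN]; exact h1 i hi hN
  · rw [hfg i hN]; exact h2 i hi hN

theorem neg (h : SingleCut N f) : SingleCut N (fun i => -f i) := by
  obtain ⟨ε, hε, p, h1, h2⟩ := h
  refine ⟨-ε, by rcases hε with rfl | rfl <;> simp, p, fun i hi hN => ?_, fun i hi hN => ?_⟩
  · simpa using h1 i hi hN
  · simpa using h2 i hi hN

/-- Omitting one index does not create sign changes. -/
theorem skip {n : ℕ} (h : SingleCut (N + 1) f) :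
    SingleCut N (fun i => if i < n then f i else f (i + 1)) := by
  obtain ⟨ε, hε, p, h1, h2⟩ := h
  refine ⟨ε, hε, if p ≤ n then p else p - 1, fun i hi hN => ?_, fun i hi hN => ?_⟩ <;>
    dsimp only <;> by_cases hin : i < n
  · rw [if_pos hin]; exact h1 _ (by split_ifs at hi <;> omega) (by omega)
  · rw [if_neg hin]; exact h1 _ (by split_ifs at hi <;> omega) (by omega)
  · rw [if_pos hin]; exact h2 _ (by split_ifs at hi <;> omega) (by omega)
  · rw [if_neg hin]; exact h2 _ (by split_ifs at hi <;> omega) (by omega)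

/-- Replacing a value by a positive combination with its right neighbour does not create sign
changes. -/
theorem mix {k : ℕ} {c : ℝ} (hc : 0 < c) (h : SingleCut N f) (hk : k + 1 < N)
    (hg : ∀ i, i ≠ k → g i = f i) (hgk : c * g k = f k + f (k + 1)) : SingleCut N g := by
  obtain ⟨ε, hε, p, h1, h2⟩ := h
  have hε' : c * (ε * g k) = ε * f k + ε * f (k + 1) := by linear_combination ε * hgk
  rcases lt_trichotomy p (k + 1) with hp | hp | hp
  · have e : ε * g k ≤ 0 := by
      have := h2 k (by omega) (by omega)
      have := h2 (k + 1) (by omega) (by omega)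
      by_contra hcon
      nlinarith [mul_pos hc (not_le.1 hcon)]
    refine ⟨ε, hε, p, fun i hi hN => ?_, fun i hi hN => ?_⟩
    · rw [hg i (by omega)]; exact h1 i hi hN
    · by_cases hik : i = k
      · rw [hik]; exact e
      · rw [hg i hik]; exact h2 i hi hN
  -- The cut lies exactly between `k` and `k + 1`. The new value may have either sign, which decides
  -- whether the cut stays in place or moves to `k`.
  · rcases le_total 0 (ε * g k) with e | e
    · refine ⟨ε, hε, p, fun i hi hN => ?_, fun i hi hN => ?_⟩
      · by_cases hik : i = k
        · rw [hik]; exact e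
        · rw [hg i hik]; exact h1 i hi hN
      · rw [hg i (by omega)]; exact h2 i hi hN
    · refine ⟨ε, hε, k, fun i hi hN => ?_, fun i hi hN => ?_⟩
      · rw [hg i (by omega)]; exact h1 i (by omega) hN
      · by_cases hik : i = k
        · rw [hik]; exact e
        · rw [hg i hik]; exact h2 i (by omega) hN
  · have e : 0 ≤ ε * g k := by
      have := h1 k (by omega) (by omega)
      have := h1 (k + 1) (by omega) (by omega)
      by_contra hcon
      nlinarith [mul_pos hc (neg_pos.2 (not_le.1 hcon))]
    refine ⟨ε, hε, p, fun i hi hN => ?_, fun i hi hN => ?_⟩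
    · by_cases hik : i = k
      · rw [hik]; exact e
      · rw [hg i hik]; exact h1 i hi hN
    · rw [hg i (by omega)]; exact h2 i hi hN

/-- Appending a value of sign opposite to the first one keeps the number of sign changes. -/
theorem append {w : ℝ} (hw : 0 < w) (h : SingleCut N f) (hN : 0 < N) (hf : f N = -w * f 0) :
    SingleCut (N + 1) f := by
  obtain ⟨ε, hε, p, h1, h2⟩ := h
  -- If the cut is at 0, all old values share one weak sign and the new one has the other, so the
  -- cut can be placed at `N` after flipping `ε`. Otherwise `f 0` lies on the first side and the new
  -- value joins the second.
  by_cases hp : p = 0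
  · refine ⟨-ε, by rcases hε with rfl | rfl <;> simp, N, fun i _ hi' => ?_, fun i hi hi' => ?_⟩
    · have := h2 i (by omega) (by omega); linarith
    · obtain rfl : i = N := by omega
      have := h2 0 (by omega) hN
      rw [hf]; nlinarith
  · refine ⟨ε, hε, min p N, fun i hi hi' => ?_, fun i hi hi' => ?_⟩
    · exact h1 i (by omega) (by omega)
    · rcases (by omega : i = N ∨ i < N) with rfl | hiN
      · have := h1 0 (by omega) hN
        rw [hf]; nlinarith
      · exact h2 i (by omega) hiN

theorem not_pos_neg_pos (h : SingleCut N f) {i j k : ℕ} (hij : i < j) (hjk : j < k) (hk : k < N)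
    (hi : 0 < f i) (hj : f j < 0) (hk' : 0 < f k) : False := by
  obtain ⟨ε, hε, p, h1, h2⟩ := h
  rcases hε with rfl | rfl
  · rcases lt_or_ge j p with hp | hp
    · have := h1 j hp (by omega); linarith
    · have := h2 k (by omega) hk; linarith
  · rcases lt_or_ge i p with hp | hp
    · have := h1 i hp (by omega); linarith
    · have := h2 j (by omega) (by omega); linarith

end SingleCut

/-! ### Sign changes along the flow. -/

namespace CyclicFlow

variable {n r : ℕ} {τ : ℕ → ℝ} {w : ℝ} {x : ℕ → ℕ → ℝ}

/-- One time step is a chain of elementary operations. Omitting cell `n` turns the shifted delay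
line into its new state. The filters are then updated from right to left, each new value being a
positive combination of the old value and the new right neighbour. Finally the feedback value is
appended, with sign opposite to that of cell 0. -/
theorem singleCut (hx : CyclicFlow n r τ w x) (hn : 1 ≤ n) (hr : 1 ≤ r) (hτ : ∀ i, 0 < τ i)
    (hw : 0 < w) (m : ℕ) : SingleCut (n + r + 1) (x m) := by
  induction m with
  | zero =>
    refine ⟨1, Or.inl rfl, n, fun i hi _ => ?_, fun i hi hi' => ?_⟩
    · simpa using (hx.init_pos i hi).le
    · rcases (by omega : i = n + r ∨ i < n + r) with rfl | h
      · rw [hx.feedback]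
        nlinarith [hx.init_pos 0 (by omega)]
      · simp [hx.init_zero i hi h]
  | succ m ih =>
    have key : ∀ j ≤ n, SingleCut (n + r)
        (fun i => if i < n - j then x m i else x (m + 1) i) := by
      intro j
      induction j with
      | zero =>
        intro _
        refine (ih.skip (n := n)).congr fun i hi => ?_
        simp only [Nat.sub_zero]
        split_ifs with h
        · rfl
        · exact hx.delay m i (by omega) hi
      | succ j ihj =>
        intro hj
        refine (ihj (by omega)).mix (k := n - (j + 1)) (hτ (n - (j + 1))) (by omega)
          (fun i hi => ?_) ?_
        · by_cases h : i < n - (j + 1)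
          · rw [if_pos h, if_pos (by omega)]
          · rw [if_neg h, if_neg (by omega)]
        · rw [if_neg (by omega), if_pos (by omega), if_neg (by omega)]
          exact hx.filter m _ (by omega)
    have h := (key n le_rfl).congr (g := x (m + 1)) fun i _ => by simp
    exact h.append hw (by omega) (hx.feedback (m + 1))

/-- A state that vanishes at `0` cannot start with a negative value followed by a positive one. -/
theorem not_neg_pos (hx : CyclicFlow n r τ w x) (hn : 1 ≤ n) (hr : 1 ≤ r) (hτ : ∀ i, 0 < τ i)
    (hw : 0 < w) {σ : ℝ} (hσ : σ = 1 ∨ σ = -1) (m : ℕ) {i l : ℕ} (h0 : σ * x m 0 = 0)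
    (hil : i < l) (hl : l ≤ n + r) (hi : σ * x m i < 0) (hl' : 0 < σ * x m l)
    (hlt : ∀ k < i, σ * x m k = 0) : False := by
  have hσ0 : σ ≠ 0 := by rcases hσ with rfl | rfl <;> norm_num
  have hcut : ∀ m, SingleCut (n + r + 1) (fun i => σ * x m i) := fun m => by
    have := hx.singleCut hn hr hτ hw m
    rcases hσ with rfl | rfl
    · simpa using this
    · simpa using this.neg
  induction m generalizing i l with
  | zero =>
    have := hx.init_pos 0 (by omega)
    rcases mul_eq_zero.1 h0 with h | h
    · exact hσ0 h
    · linarith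
  | succ m ih =>
    -- The argument goes back one time step, from `v` to its predecessor `u`. Either `u` shows the
    -- pattern +, -, +, which a single cut forbids, or the forbidden pattern of `v` is already
    -- present in `u`.
    set v : ℕ → ℝ := fun i => σ * x (m + 1) i with hv
    set u : ℕ → ℝ := fun i => σ * x m i with hu
    have hf : ∀ i < n, u i = τ i * v i - v (i + 1) := fun i hi => by
      simp only [hu, hv]; linear_combination (-σ) * hx.filter m i hi
    have hd : ∀ i, n ≤ i → i < n + r → u (i + 1) = v i := fun i h1 h2 => by
      simp only [hu, hv]; rw [hx.delay m i h1 h2]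
    have hvN : v (n + r) = 0 := by
      simp only [hv]; rw [hx.feedback]; linear_combination (-w) * h0
    have hi0 : i ≠ 0 := by rintro rfl; linarith
    have hlN : l ≠ n + r := by rintro rfl; exact hl'.ne' hvN
    by_cases hin : i ≤ n
    -- `L` is the last positive cell before the feedback cell, and `J` below is the last negative
    -- cell before `L`. Their right neighbours have the opposite weak sign, so solving the filter
    -- equation backwards keeps the strict signs at `J` and `L`; in the delay line these signs sit
    -- one cell further.
    · obtain ⟨L, ⟨hL1, hL2, hL3⟩, hLmax⟩ : ∃ L, (i < L ∧ L < n + r ∧ 0 < v L) ∧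
          ∀ k, L < k → ¬ (i < k ∧ k < n + r ∧ 0 < v k) := by
        have hex : ∃ d, i < n + r - d ∧ n + r - d < n + r ∧ 0 < v (n + r - d) :=
          ⟨n + r - l, by omega, by omega, by
            rw [show n + r - (n + r - l) = l by omega]; exact hl'⟩
        classical
        refine ⟨n + r - Nat.find hex, Nat.find_spec hex, fun k hk hk' => ?_⟩
        refine Nat.find_min hex (m := n + r - k) (by omega) ?_
        rw [show n + r - (n + r - k) = k by omega]
        exact hk'
      have hLs : v (L + 1) ≤ 0 := by
        rcases (by omega : L + 1 = n + r ∨ L + 1 < n + r) with h | h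
        · rw [h, hvN]
        · by_contra hcon
          exact hLmax (L + 1) (by omega) ⟨by omega, h, not_le.1 hcon⟩
      obtain ⟨J, ⟨hJ1, hJ2, hJ3⟩, hJmax⟩ : ∃ J, (i ≤ J ∧ J < L ∧ v J < 0) ∧
          ∀ k, J < k → ¬ (i ≤ k ∧ k < L ∧ v k < 0) := by
        have hex : ∃ d, i ≤ L - d ∧ L - d < L ∧ v (L - d) < 0 :=
          ⟨L - i, by omega, by omega, by
            rw [show L - (L - i) = i by omega]; exact hi⟩
        classical
        refine ⟨L - Nat.find hex, Nat.find_spec hex, fun k hk hk' => ?_⟩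
        refine Nat.find_min hex (m := L - k) (by omega) ?_
        rw [show L - (L - k) = k by omega]
        exact hk'
      have hJs : 0 ≤ v (J + 1) := by
        rcases (by omega : J + 1 = L ∨ J + 1 < L) with h | h
        · rw [h]; exact hL3.le
        · by_contra hcon
          exact hJmax (J + 1) (by omega) ⟨by omega, h, not_le.1 hcon⟩
      have u1 : 0 < u (i - 1) := by
        rw [hf (i - 1) (by omega), show i - 1 + 1 = i by omega]
        rw [show v (i - 1) = 0 from hlt (i - 1) (by omega), mul_zero, zero_sub]
        exact neg_pos.2 hi
      have u2 : u (if J < n then J else J + 1) < 0 := by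
        split_ifs with h
        · rw [hf J h]; nlinarith [mul_pos (hτ J) (neg_pos.2 hJ3)]
        · rw [hd J (by omega) (by omega)]; exact hJ3
      have u3 : 0 < u (if L < n then L else L + 1) := by
        split_ifs with h
        · rw [hf L h]; nlinarith [mul_pos (hτ L) hL3]
        · rw [hd L (by omega) (by omega)]; exact hL3
      exact (hcut m).not_pos_neg_pos (by split_ifs <;> omega) (by split_ifs <;> omega)
        (by split_ifs <;> omega) u1 u2 u3
    -- The first nonzero cell lies inside the delay line. Then all filters of `u` vanish and the
    -- pattern is shifted by one cell. Only `u n`, which leaves no trace in `v`, is free, and its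
    -- sign decides between induction and a direct contradiction.
    · have hz : ∀ k < n, u k = 0 := fun k hk => by
        have h1 : v k = 0 := hlt k (by omega)
        have h2 : v (k + 1) = 0 := hlt (k + 1) (by omega)
        rw [hf k hk, h1, h2]; simp
      have hi1 : u (i + 1) < 0 := by rw [hd i (by omega) (by omega)]; exact hi
      have hl1 : 0 < u (l + 1) := by rw [hd l (by omega) (by omega)]; exact hl'
      have hz' : ∀ k, n < k → k < i + 1 → u k = 0 := fun k hk hk' => by
        obtain ⟨k, rfl⟩ : ∃ j, k = j + 1 := ⟨k - 1, by omega⟩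
        rw [hd k (by omega) (by omega)]; exact hlt k (by omega)
      rcases lt_trichotomy (u n) 0 with h | h | h
      · exact ih (i := n) (l := l + 1) (hz 0 (by omega)) (by omega) (by omega) h hl1 hz
      · refine ih (i := i + 1) (l := l + 1) (hz 0 (by omega)) (by omega) (by omega) hi1 hl1
          fun k hk => ?_
        rcases lt_trichotomy k n with h' | h' | h'
        · exact hz k h'
        · rw [h']; exact h
        · exact hz' k h' hk
      · exact (hcut m).not_pos_neg_pos (i := n) (j := i + 1) (k := l + 1) (by omega) (by omega)
          (by omega) h hi1 hl1

end CyclicFlow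

/-! ### Pairing a state with weights of increasing phase. -/

namespace CyclicFlow

variable {n r : ℕ} {τ : ℕ → ℝ} {w : ℝ} {x : ℕ → ℕ → ℝ}

/-- If a state `v` is paired with weights of increasing phases `φ`, of total winding less than
`π`, into a number of phase `η + φ (n + r)`, then the first component of `v` is negative. -/
theorem neg_of_pairing (hx : CyclicFlow n r τ w x) (hn : 1 ≤ n) (hr : 1 ≤ r)
    (hnr : 1 < max n r) (hτ : ∀ i, 0 < τ i) (hw : 0 < w) {σ : ℝ} (hσ : σ = 1 ∨ σ = -1) (m : ℕ)
    {M φ : ℕ → ℝ} {K η : ℝ} (hM : ∀ i, i ≠ n → 0 < M i) (hMn : M n = 0)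
    (hφ : ∀ i j, i ≤ j → j ≤ n + r → φ i ≤ φ j) (hη : 0 ≤ η) (hK : 0 < K)
    (hwind : η + φ (n + r) - φ 0 < π)
    (hpair : ∀ ψ, ∑ i ∈ Finset.range (n + r + 1), σ * x m i * M i * sin (φ i - ψ) =
      K * sin (η + φ (n + r) - ψ))
    (hstrict : 0 < η ∨ ((n, r) ≠ (2, 1) ∧ (2 ≤ r → φ (n + r - 1) < φ (n + r)) ∧
      (2 ≤ n → φ (n - 2) < φ (n + r)))) :
    σ * x m 0 < 0 := by
  by_contra! h0
  have hM0 : ∀ i, 0 ≤ M i := fun i => by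
    by_cases h : i = n
    · rw [h, hMn]
    · exact (hM i h).le
  have hlast : σ * x m (n + r) = -w * (σ * x m 0) := by rw [hx.feedback]; ring
  have hlast' : σ * x m (n + r) ≤ 0 := by rw [hlast]; nlinarith
  have hrange : ∀ i j, i ≤ n + r → j ≤ n + r → φ i - φ j < π := fun i j hi hj => by
    have := hφ i (n + r) hi le_rfl
    have := hφ 0 j (by omega) hj
    linarith
  -- a state with a descending cut is excluded
  have main : ∀ p, 1 ≤ p → p ≤ n + r → (∀ i < p, 0 ≤ σ * x m i) →
      (∀ i, p ≤ i → i ≤ n + r → σ * x m i ≤ 0) → False := by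
    intro p hp1 hp2 hpos hneg
    -- Project orthogonally to the phase `φ (p - 1)`. Nonnegative entries come with phases before it
    -- and nonpositive entries with phases after it, so every term pulls to the same side, opposite
    -- to that of the prescribed value.
    have hterm : ∀ i ∈ Finset.range (n + r + 1),
        σ * x m i * M i * sin (φ i - φ (p - 1)) ≤ 0 := by
      intro i hi
      have hi : i ≤ n + r := by rw [Finset.mem_range] at hi; omega
      rcases lt_or_ge i p with h | h
      · have h1 := hφ i (p - 1) (by omega) (by omega)
        have h2 := hrange (p - 1) i (by omega) hi
        exact mul_nonpos_of_nonneg_of_nonpos (mul_nonneg (hpos i h) (hM0 i))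
          (sin_nonpos_of_nonpos_of_neg_pi_le (by linarith) (by linarith))
      · have h1 := hφ (p - 1) i (by omega) hi
        have h2 := hrange i (p - 1) hi (by omega)
        exact mul_nonpos_of_nonpos_of_nonneg
          (mul_nonpos_of_nonpos_of_nonneg (hneg i h hi) (hM0 i))
          (sin_nonneg_of_nonneg_of_le_pi (by linarith) (by linarith))
    have hle := Finset.sum_nonpos hterm
    have hp3 := hφ (p - 1) (n + r) (by omega) le_rfl
    have hp4 := hφ 0 (p - 1) (by omega) (by omega)
    by_cases hgt : 0 < η + φ (n + r) - φ (p - 1)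
    · rw [hpair] at hle
      have := mul_pos hK (sin_pos_of_pos_of_lt_pi hgt (by linarith))
      linarith
    -- Degenerate case: the value is aligned with `φ (p - 1)`, so every term of the projection
    -- vanishes. The strictness assumptions leave only r = 1 and n ≥ 3, with all entries before `n -
    -- 1` equal to zero.
    · have hη0 : η = 0 := by linarith
      have hpe : φ (p - 1) = φ (n + r) := by linarith
      obtain ⟨hne, hs1, hs2⟩ := hstrict.resolve_left (by linarith)
      have hr1 : r = 1 := by
        by_contra hcon
        have h1 := hs1 (by omega)
        have h2 := hφ (p - 1) (n + r - 1) (by omega) (by omega)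
        linarith
      have hn3 : 3 ≤ n := by
        rw [hr1] at hnr
        rcases lt_max_iff.1 hnr with h | h
        · by_contra hcon
          exact hne (by rw [hr1, show n = 2 by omega])
        · omega
      have hφn : ∀ i, i + 1 < n → φ i < φ (n + r) := fun i hi =>
        (hφ i (n - 2) (by omega) (by omega)).trans_lt (hs2 (by omega))
      have hpn : n ≤ p := by
        by_contra hcon
        have := hφn (p - 1) (by omega)
        linarith
      have hsum0 : ∑ i ∈ Finset.range (n + r + 1), σ * x m i * M i * sin (φ i - φ (p - 1)) = 0 := by
        rw [hpair, hη0, hpe]; simp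
      have hz := (Finset.sum_eq_zero_iff_of_nonpos hterm).1 hsum0
      have hv0 : ∀ i, i + 1 < n → σ * x m i = 0 := fun i hi => by
        have h1 := hz i (Finset.mem_range.2 (by omega))
        have h2 := hφn i hi
        have h3 := hrange (p - 1) i (by omega) (by omega)
        have h4 : sin (φ i - φ (p - 1)) < 0 :=
          sin_neg_of_neg_of_neg_pi_lt (by linarith) (by linarith)
        rcases mul_eq_zero.1 h1 with h | h
        · rcases mul_eq_zero.1 h with h | h
          · exact h
          · exact absurd h (hM i (by omega)).ne'
        · exact absurd h h4.ne
      have hvlast : σ * x m (n + 1) = 0 := by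
        rw [hr1] at hlast
        rw [hlast, hv0 0 (by omega), mul_zero]
      -- Otherwise all weighted entries vanish, whereas the pairing has modulus `K > 0`.
      have hvn : 0 < σ * x m (n - 1) := by
        refine lt_of_le_of_ne (hpos _ (by omega)) fun hcon => ?_
        have h1 := hpair (φ (n + r) - π / 2)
        rw [Finset.sum_eq_zero, hη0] at h1
        · rw [show 0 + φ (n + r) - (φ (n + r) - π / 2) = π / 2 by ring, sin_pi_div_two] at h1
          linarith
        · intro i hi
          rw [Finset.mem_range] at hi
          rcases (by omega : i + 1 < n ∨ i = n - 1 ∨ i = n ∨ i = n + 1) with h | h | h | h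
          · rw [hv0 i h]; ring
          · rw [h, ← hcon]; ring
          · rw [h, hMn]; ring
          · rw [h, hvlast]; ring
      cases m with
      | zero =>
        have h1 := hx.init_pos 0 (by omega)
        have h2 := hv0 0 (by omega)
        rcases hσ with rfl | rfl <;> linarith
      | succ m =>
        have hf : ∀ i < n, σ * x m i = τ i * (σ * x (m + 1) i) - σ * x (m + 1) (i + 1) :=
          fun i hi => by linear_combination (-σ) * hx.filter m i hi
        have hu : ∀ k < n - 2, σ * x m k = 0 := fun k hk => by
          rw [hf k (by omega), hv0 k (by omega), hv0 (k + 1) (by omega)]; ring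
        -- Here n ≥ 3 is needed, so that cell 0 of the preceding state is among the vanishing ones.
        -- That state then starts with zeros followed by a negative and a positive entry.
        have hn' : σ * x (m + 1) n = 0 := by
          rw [hx.delay m n le_rfl (by omega), ← hr1, hx.feedback]
          linear_combination (-w) * hu 0 (by omega)
        refine hx.not_neg_pos hn hr hτ hw hσ m (i := n - 2) (l := n - 1) (hu 0 (by omega))
          (by omega) (by omega) ?_ ?_ hu
        · rw [hf (n - 2) (by omega), hv0 (n - 2) (by omega), show n - 2 + 1 = n - 1 by omega]
          linarith
        · rw [hf (n - 1) (by omega), show n - 1 + 1 = n by omega, hn', sub_zero]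
          exact mul_pos (hτ _) hvn
  have hcut : SingleCut (n + r + 1) (fun i => σ * x m i) := by
    have := hx.singleCut hn hr hτ hw m
    rcases hσ with rfl | rfl
    · simpa using this
    · simpa using this.neg
  by_cases hnonneg : ∀ i < n + r, 0 ≤ σ * x m i
  · refine main (n + r) (by omega) le_rfl hnonneg fun i hi hi' => ?_
    rw [le_antisymm hi' hi]; exact hlast'
  by_cases hnonpos : ∀ i, 1 ≤ i → i ≤ n + r → σ * x m i ≤ 0
  · refine main 1 le_rfl (by omega) (fun i hi => ?_) hnonpos
    rw [Nat.lt_one_iff.1 hi]; exact h0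
  push Not at hnonneg hnonpos
  obtain ⟨i₁, hi₁, hi₁'⟩ := hnonneg
  obtain ⟨l, hl1, hl, hl'⟩ := hnonpos
  obtain ⟨ε, hε, p, h1, h2⟩ := hcut
  rcases hε with rfl | rfl
  -- The cut `p` may be 0 or exceed `n + r`. Clamping it is harmless because the signs at both ends
  -- are known from `h0` and `hlast'`.
  · refine main (max 1 (min p (n + r))) (by omega) (by omega) (fun i hi => ?_) fun i hi hi' => ?_
    · by_cases h : i = 0
      · rw [h]; exact h0
      · simpa using h1 i (by omega) (by omega)
    · rcases (by omega : i = n + r ∨ i < n + r) with h | h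
      · rw [h]; exact hlast'
      · simpa using h2 i (by omega) (by omega)
  -- For an ascending cut the entry at 0 is both nonpositive and nonnegative, hence zero, and
  -- `not_neg_pos` applies.
  · have hpi : i₁ < p := by
      by_contra hcon
      have := h2 i₁ (by omega) (by omega)
      linarith
    have hpl : p ≤ l := by
      by_contra hcon
      have := h1 l (by omega) (by omega)
      linarith
    have hle : ∀ i < p, σ * x m i ≤ 0 := fun i hi => by
      have := h1 i hi (by omega)
      linarith
    have hz : σ * x m 0 = 0 := le_antisymm (hle 0 (by omega)) h0
    classical
    have hex : ∃ i, i < n + r ∧ σ * x m i < 0 := ⟨i₁, hi₁, hi₁'⟩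
    have hfi : Nat.find hex ≤ i₁ := Nat.find_min' hex ⟨hi₁, hi₁'⟩
    refine hx.not_neg_pos hn hr hτ hw hσ m (i := Nat.find hex) (l := l) hz (by omega) hl
      (Nat.find_spec hex).2 hl' fun k hk => ?_
    have := Nat.find_min hex hk
    push Not at this
    exact le_antisymm (hle k (by omega)) (this (by omega))

end CyclicFlow

/-! ### The left eigenvector of the flow and the sign of its output. -/

/-- Summation by parts along a chain of first-order filters. -/
theorem sum_filter_chain (n : ℕ) (t : ℂ) (τ y u : ℕ → ℂ)
    (h : ∀ k < n, τ k * y k = u k + y (k + 1)) :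
    t * ∑ k ∈ Finset.range n, y k * ∏ j ∈ Finset.Ico (k + 1) n, (τ j - t) =
      ∑ k ∈ Finset.range n, u k * ∏ j ∈ Finset.Ico (k + 1) n, (τ j - t) + y n -
        y 0 * ∏ j ∈ Finset.range n, (τ j - t) := by
  have h1 := Finset.sum_range_sub (fun k => y k * ∏ j ∈ Finset.Ico k n, (τ j - t)) n
  simp only [Finset.Ico_self, Finset.prod_empty, mul_one, ← Finset.range_eq_Ico] at h1
  rw [add_sub_assoc, ← h1, ← Finset.sum_add_distrib, Finset.mul_sum]
  refine Finset.sum_congr rfl fun k hk => ?_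
  rw [Finset.mem_range] at hk
  rw [Finset.prod_eq_prod_Ico_succ_bot hk]
  linear_combination (∏ j ∈ Finset.Ico (k + 1) n, (τ j - t)) * h k hk

namespace CyclicFlow

variable {n r : ℕ} {τ : ℕ → ℝ} {w : ℝ} {x : ℕ → ℕ → ℝ}

/-- The left eigenvector attached to a root `t` of `∏ (τⱼ - t) + w t ^ r`, evaluated on the
state produced by an impulse of size `c`. -/
theorem leftEigenvector (hx : CyclicFlow n r τ w x) (hn : 1 ≤ n) (hr : 1 ≤ r) {c : ℝ}
    (hinit : ∀ i, i + 1 < n → τ i * x 0 i = x 0 (i + 1)) (hc : τ (n - 1) * x 0 (n - 1) = c)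
    {t : ℂ} (ht : ∏ j ∈ Finset.range n, ((τ j : ℂ) - t) = -w * t ^ r) (m : ℕ) :
    t ^ (m + 1) * (∑ k ∈ Finset.range n, (x m k : ℂ) * ∏ j ∈ Finset.Ico (k + 1) n, ((τ j : ℂ) - t) +
      ∑ i ∈ Finset.range r, (x m (n + 1 + i) : ℂ) * t ^ i) = c := by
  obtain ⟨r, rfl⟩ : ∃ q, r = q + 1 := ⟨r - 1, by omega⟩
  induction m with
  | zero =>
    -- The initial state is the response of the filter chain to no input, with final output `c`;
    -- this value is put in position `n`.
    have h1 := sum_filter_chain n t (fun j => (τ j : ℂ)) (fun k => if k < n then (x 0 k : ℂ) else c)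
      (fun _ => 0) fun k hk => by
        simp only [hk, if_true, zero_add]
        split_ifs with h
        · rw [← hinit k h]; push_cast; ring
        · obtain rfl : k = n - 1 := by omega
          rw [← hc]; push_cast; ring
    rw [Finset.sum_congr rfl fun k hk => by rw [if_pos (Finset.mem_range.1 hk)], ht] at h1
    simp only [zero_mul, Finset.sum_const_zero, lt_irrefl, if_false, if_pos (show 0 < n by omega)]
      at h1
    rw [zero_add, pow_one, mul_add, h1, Finset.sum_range_succ, Finset.sum_eq_zero]
    · rw [show n + 1 + r = n + (r + 1) by ring, hx.feedback]
      push_cast; ring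
    · intro i hi
      rw [Finset.mem_range] at hi
      rw [hx.init_zero _ (by omega) (by omega)]; simp
  | succ m ih =>
    rw [← ih, pow_succ t (m + 1), mul_assoc]
    congr 1
    have h1 := sum_filter_chain n t (fun j => (τ j : ℂ)) (fun k => (x (m + 1) k : ℂ))
      (fun k => (x m k : ℂ)) fun k hk => by exact_mod_cast hx.filter m k hk
    rw [ht] at h1
    have h2 : t * ∑ i ∈ Finset.range r, (x (m + 1) (n + 1 + i) : ℂ) * t ^ i =
        ∑ i ∈ Finset.range r, (x m (n + 1 + (i + 1)) : ℂ) * t ^ (i + 1) := by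
      rw [Finset.mul_sum]
      refine Finset.sum_congr rfl fun i hi => ?_
      rw [Finset.mem_range] at hi
      rw [hx.delay m (n + 1 + i) (by omega) (by omega), ← add_assoc]
      ring
    rw [Finset.sum_range_succ, Finset.sum_range_succ', show n + 1 + r = n + (r + 1) by ring,
      hx.feedback, ← h2, mul_add, h1, hx.delay m n le_rfl (by omega)]
    push_cast; ring

/-- With αⱼ = π - θⱼ, the filter weights ∏_{j > k} (τⱼ - t) have argument -∑_{j > k} αⱼ and the
delay weights t^i have argument iθ. Both increase along the cycle, which is the setting of
`neg_of_pairing`. -/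
theorem sign (hx : CyclicFlow n r τ w x) (hn : 1 ≤ n) (hr : 1 ≤ r) (hnr : 1 < max n r)
    (hτ : ∀ i, 0 < τ i) (hw : 0 < w) {c : ℝ} (hc0 : 0 < c)
    (hinit : ∀ i, i + 1 < n → τ i * x 0 i = x 0 (i + 1)) (hc : τ (n - 1) * x 0 (n - 1) = c)
    {s θ : ℝ} (hs : 0 < s) (hθ : 0 < θ) {α ρ : ℕ → ℝ} (hα : ∀ j, 0 < α j) (hρ : ∀ j, 0 < ρ j)
    (hsum : ∑ j ∈ Finset.range n, α j = π - r * θ)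
    (hpolar : ∀ j < n, (τ j : ℂ) - s * Complex.exp (θ * Complex.I) =
      ρ j * Complex.exp (-(α j) * Complex.I))
    (hprod : ∏ j ∈ Finset.range n, ρ j = w * s ^ r) {m h : ℕ} {κ : ℝ} (hκ0 : 0 ≤ κ) (hκ1 : κ < 1)
    (hκ : 0 < κ ∨ (n, r) ≠ (2, 1)) (hh : (m + r + κ) * θ = h * π) :
    (-1) ^ h * x m 0 < 0 := by
  set t : ℂ := s * Complex.exp (θ * Complex.I) with ht
  have hprods : ∀ S : Finset ℕ, (∀ j ∈ S, j < n) → ∏ j ∈ S, ((τ j : ℂ) - t) =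
      (∏ j ∈ S, ρ j : ℝ) * Complex.exp ((-∑ j ∈ S, α j : ℝ) * Complex.I) := fun S hS => by
    rw [Finset.prod_congr rfl fun j hj => hpolar j (hS j hj), Finset.prod_mul_distrib,
      ← Complex.exp_sum]
    push_cast
    rw [neg_mul, Finset.sum_mul, ← Finset.sum_neg_distrib]
    simp only [neg_mul]
  have htpow : ∀ k : ℕ, t ^ k = (s ^ k : ℝ) * Complex.exp ((k * θ : ℝ) * Complex.I) := fun k => by
    rw [ht, mul_pow, ← Complex.exp_nat_mul]
    push_cast; ring_nf
  have hroot : ∏ j ∈ Finset.range n, ((τ j : ℂ) - t) = -w * t ^ r := by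
    rw [hprods _ fun j hj => Finset.mem_range.1 hj, hprod, hsum, htpow,
      show ((-(π - r * θ) : ℝ) : ℂ) * Complex.I = (r * θ : ℝ) * Complex.I - π * Complex.I by
        push_cast; ring, Complex.exp_sub, Complex.exp_pi_mul_I]
    push_cast; ring
  have heig := hx.leftEigenvector hn hr hinit hc hroot m
  -- Cell `n` does not enter the eigenvector and gets weight 0. Truncated subtraction gives it phase
  -- 0, which keeps `φ` monotone.
  set φ : ℕ → ℝ := fun i => if i < n then -∑ j ∈ Finset.Ico (i + 1) n, α j
    else ((i - n - 1 : ℕ) : ℝ) * θ with hφ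
  set M : ℕ → ℝ := fun i => if i < n then ∏ j ∈ Finset.Ico (i + 1) n, ρ j
    else if i = n then 0 else s ^ (i - n - 1) with hM
  have hE : ∑ i ∈ Finset.range (n + r + 1), (x m i * M i : ℝ) * Complex.exp (φ i * Complex.I) =
      c * (s ^ (m + 1) : ℝ)⁻¹ * Complex.exp ((-((m + 1) * θ) : ℝ) * Complex.I) := by
    have e1 : ((s ^ (m + 1) : ℝ) : ℂ) ≠ 0 := by exact_mod_cast (pow_pos hs _).ne'
    have e2 : t ^ (m + 1) ≠ 0 := by
      rw [htpow]; exact mul_ne_zero e1 (Complex.exp_ne_zero _)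
    have e3 : c * (s ^ (m + 1) : ℝ)⁻¹ * Complex.exp ((-((m + 1) * θ) : ℝ) * Complex.I) =
        (t ^ (m + 1))⁻¹ * c := by
      rw [htpow, mul_inv, ← Complex.exp_neg]
      push_cast; ring_nf
    rw [e3, ← heig, inv_mul_cancel_left₀ e2, show n + r + 1 = n + (r + 1) by ring,
      Finset.sum_range_add]
    congr 1
    · refine Finset.sum_congr rfl fun k hk => ?_
      rw [Finset.mem_range] at hk
      rw [hprods _ fun j hj => (Finset.mem_Ico.1 hj).2]
      simp only [hφ, hM, if_pos hk]
      push_cast; ring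
    · rw [Finset.sum_range_succ']
      simp only [hM, add_zero, lt_irrefl, if_false, if_true, mul_zero, Complex.ofReal_zero, zero_mul]
      refine Finset.sum_congr rfl fun k _ => ?_
      simp only [hφ]
      rw [if_neg (by omega), if_neg (by omega), if_neg (by omega), htpow,
        show n + (k + 1) - n - 1 = k by omega, show n + 1 + k = n + (k + 1) by ring]
      push_cast; ring
  have hσ : ((-1 : ℝ) ^ h = 1 ∨ (-1 : ℝ) ^ h = -1) := neg_one_pow_eq_or ℝ h
  have hαm : ∀ i j, i ≤ j → ∑ k ∈ Finset.Ico (j + 1) n, α k ≤ ∑ k ∈ Finset.Ico (i + 1) n, α k :=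
    fun i j hij => Finset.sum_le_sum_of_subset_of_nonneg
      (Finset.Ico_subset_Ico_left (by omega)) fun k _ _ => (hα k).le
  have hαn : ∀ i, 0 ≤ ∑ k ∈ Finset.Ico (i + 1) n, α k := fun i =>
    Finset.sum_nonneg fun k _ => (hα k).le
  have hφN : φ (n + r) = (r - 1) * θ := by
    simp only [hφ]
    rw [if_neg (by omega), show n + r - n - 1 = r - 1 by omega, Nat.cast_sub hr, Nat.cast_one]
  have hφ0 : φ 0 = α 0 - (π - r * θ) := by
    simp only [hφ]
    rw [if_pos (by omega), ← hsum, Finset.range_eq_Ico, Finset.sum_eq_sum_Ico_succ_bot (show 0 < n by omega)]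
    ring
  refine hx.neg_of_pairing hn hr hnr hτ hw hσ m (M := M) (φ := φ)
    (K := c * (s ^ (m + 1))⁻¹) (η := κ * θ) (fun i hi => ?_) ?_ (fun i j hij hj => ?_) (by positivity)
    (by positivity) ?_ (fun ψ => ?_) ?_
  · simp only [hM, if_neg hi]
    split_ifs
    · exact Finset.prod_pos fun j _ => hρ j
    · positivity
  · simp [hM]
  · simp only [hφ]
    split_ifs with h1 h2 h2
    · linarith [hαm i j hij]
    · have : 0 ≤ ((j - n - 1 : ℕ) : ℝ) * θ := by positivity
      linarith [hαn i]
    · omega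
    · have : ((i - n - 1 : ℕ) : ℝ) ≤ ((j - n - 1 : ℕ) : ℝ) := by exact_mod_cast (by omega)
      exact mul_le_mul_of_nonneg_right this hθ.le
  -- The total winding equals π - (1 - κ)θ - α₀.
  · rw [hφN, hφ0]
    nlinarith [hα 0]
  · have h1 := congrArg (fun z : ℂ => (z * Complex.exp ((-ψ : ℝ) * Complex.I)).im) hE
    simp only [Finset.sum_mul, Complex.im_sum, mul_assoc] at h1
    simp only [← Complex.exp_add, ← add_mul, ← Complex.ofReal_add,
      Complex.im_ofReal_mul, Complex.exp_ofReal_mul_I_im, ← sub_eq_add_neg] at h1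
    -- The relation (m + r + κ)θ = hπ says that -(m + 1)θ = κθ + (r - 1)θ - hπ.
    have h2 : sin (-((m + 1) * θ) - ψ) = (-1) ^ h * sin (κ * θ + φ (n + r) - ψ) := by
      rw [hφN, ← sin_sub_nat_mul_pi]
      congr 1
      linarith
    rw [h2] at h1
    have h3 : ((-1 : ℝ) ^ h) * (-1) ^ h = 1 := by rcases hσ with e | e <;> rw [e] <;> norm_num
    simp only [mul_assoc] at h1 ⊢
    rw [← Finset.mul_sum, h1]
    linear_combination (c * ((s ^ (m + 1))⁻¹ * sin (κ * θ + φ (n + r) - ψ))) * h3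
  · rcases hκ with h1 | h1
    · exact Or.inl (by positivity)
    · refine Or.inr ⟨h1, fun h2 => ?_, fun h2 => ?_⟩
      · rw [hφN]
        simp only [hφ]
        rw [if_neg (by omega), show n + r - 1 - n - 1 = r - 2 by omega, Nat.cast_sub h2]
        push_cast
        nlinarith
      · rw [hφN]
        simp only [hφ]
        rw [if_pos (by omega), show n - 2 + 1 = n - 1 by omega]
        have h3 : 0 < ∑ j ∈ Finset.Ico (n - 1) n, α j :=
          Finset.sum_pos (fun j _ => hα j) ⟨n - 1, by simp; omega⟩
        have h4 : (0 : ℝ) ≤ (r - 1) * θ := by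
          have : (1 : ℝ) ≤ r := by exact_mod_cast hr
          exact mul_nonneg (by linarith) hθ.le
        linarith

end CyclicFlow

/-! ### The generating series as a cyclic flow; degree bound. -/

/-- A finite family of reals, extended by `1` to all indices. -/
noncomputable def extendOne {n : ℕ} (τ : Fin n → ℝ) (i : ℕ) : ℝ :=
  if h : i < n then τ ⟨i, h⟩ else 1

theorem extendOne_fin {n : ℕ} (τ : Fin n → ℝ) (k : Fin n) : extendOne τ k = τ k := by
  simp [extendOne]

theorem extendOne_pos {n : ℕ} {τ : Fin n → ℝ} (hτ : ∀ k, 0 < τ k) (i : ℕ) : 0 < extendOne τ i := by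
  unfold extendOne
  split_ifs
  · exact hτ _
  · exact one_pos

/-- The specialization at `z` of the generating series `∑ H_m(z) t ^ m`. -/
noncomputable def genSeries {n : ℕ} (a : ℝ) (τ : Fin n → ℝ) (r : ℕ) (z : ℝ) : PowerSeries ℝ :=
  PowerSeries.mk fun m => (genPoly a τ r m).eval z

/-- The partial products `∏_{j < k} (τⱼ - t) · ∑ H_m(z) t ^ m`. -/
noncomputable def partialSeries {n : ℕ} (a : ℝ) (τ : Fin n → ℝ) (r : ℕ) (z : ℝ) (k : ℕ) :
    PowerSeries ℝ :=
  (∏ j ∈ Finset.range k, (PowerSeries.C (extendOne τ j) - PowerSeries.X)) * genSeries a τ r z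

/-- The flow on the cycle of `n + r` cells generated by `1 / (P(t) + z t ^ r)`. -/
noncomputable def genFlow {n : ℕ} (a : ℝ) (τ : Fin n → ℝ) (r : ℕ) (z : ℝ) (m i : ℕ) : ℝ :=
  if i < n then PowerSeries.coeff m (partialSeries a τ r z i)
  else if m + i < n + r then 0
  else -(z / a) * (genPoly a τ r (m + i - n - r)).eval z

section

variable {n : ℕ} {a : ℝ} {τ : Fin n → ℝ} {r : ℕ} {z : ℝ}

theorem denom_mul_genSeries (ha : 0 < a) (hτ : ∀ k, 0 < τ k) (hr : 1 ≤ r) (z : ℝ) :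
    ((rootPoly a τ : PowerSeries ℝ) + PowerSeries.C z * PowerSeries.X ^ r) *
      genSeries a τ r z = 1 := by
  have h := congrArg (PowerSeries.map (evalRingHom z)) (denomSeries_mul_mk_genPoly ha hτ hr)
  rw [map_mul, map_one] at h
  have h1 : PowerSeries.map (evalRingHom z) (PowerSeries.mk (genPoly a τ r)) =
      genSeries a τ r z := by
    ext m; simp [genSeries]
  have h2 : PowerSeries.map (evalRingHom z) (denomSeries a τ r) =
      (rootPoly a τ : PowerSeries ℝ) + PowerSeries.C z * PowerSeries.X ^ r := by
    have h3 : ((rootPoly a τ).map C).map (evalRingHom z) = rootPoly a τ := by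
      rw [Polynomial.map_map, show (evalRingHom z).comp C = RingHom.id ℝ from
        RingHom.ext fun x => by simp, Polynomial.map_id]
    rw [denomSeries, map_add, map_mul, map_pow, PowerSeries.map_X, PowerSeries.map_C,
      ← Polynomial.polynomial_map_coe, h3]
    simp
  rwa [h1, h2] at h

theorem rootPoly_coe (a : ℝ) (τ : Fin n → ℝ) : (rootPoly a τ : PowerSeries ℝ) =
    PowerSeries.C a * ∏ j ∈ Finset.range n, (PowerSeries.C (extendOne τ j) - PowerSeries.X) := by
  rw [rootPoly, Polynomial.coe_mul, Polynomial.coe_C, ← Fin.prod_univ_eq_prod_range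
    (fun j => PowerSeries.C (extendOne τ j) - PowerSeries.X)]
  congr 1
  rw [← Polynomial.coeToPowerSeries.ringHom_apply, map_prod]
  simp [extendOne_fin]

theorem coeff_zero_partialSeries (k : ℕ) : PowerSeries.coeff 0 (partialSeries a τ r z k) =
    (∏ j ∈ Finset.range k, extendOne τ j) * (genPoly a τ r 0).eval z := by
  simp [partialSeries, genSeries, map_prod]

theorem coeff_zero_partialSeries_eq (ha : 0 < a) (hτ : ∀ k, 0 < τ k) (hr : 1 ≤ r) :
    (∏ j ∈ Finset.range n, extendOne τ j) * (genPoly a τ r 0).eval z = a⁻¹ := by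
  have h := congrArg PowerSeries.constantCoeff (denom_mul_genSeries ha hτ hr z)
  rw [rootPoly_coe] at h
  have : r ≠ 0 := by omega
  simp [map_prod, this, genSeries] at h
  field_simp
  linarith

theorem eval_genPoly_zero_pos (ha : 0 < a) (hτ : ∀ k, 0 < τ k) (hr : 1 ≤ r) :
    0 < (genPoly a τ r 0).eval z := by
  have h := coeff_zero_partialSeries_eq (z := z) ha hτ hr
  have h1 : 0 < ∏ j ∈ Finset.range n, extendOne τ j := Finset.prod_pos fun j _ => extendOne_pos hτ j
  have h2 : 0 < a⁻¹ := by positivity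
  rw [← h] at h2
  exact pos_of_mul_pos_right h2 h1.le

theorem partialSeries_succ (k : ℕ) : partialSeries a τ r z (k + 1) =
    (PowerSeries.C (extendOne τ k) - PowerSeries.X) * partialSeries a τ r z k := by
  rw [partialSeries, Finset.prod_range_succ, partialSeries]; ring

/-- The full product satisfies a ∏ (τⱼ - t) · G = 1 - z t^r G, so the input of the last filter is
the delayed negative feedback. -/
theorem coeff_partialSeries_last (ha : 0 < a) (hτ : ∀ k, 0 < τ k) (hr : 1 ≤ r) (m : ℕ) :
    PowerSeries.coeff (m + 1) (partialSeries a τ r z n) = if m + 1 < r then 0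
      else -(z / a) * (genPoly a τ r (m + 1 - r)).eval z := by
  have h := denom_mul_genSeries ha hτ hr z
  rw [rootPoly_coe, add_mul, mul_assoc] at h
  change PowerSeries.C a * partialSeries a τ r z n + _ = _ at h
  have h1 := congrArg (PowerSeries.coeff (m + 1)) h
  rw [map_add, PowerSeries.coeff_C_mul, mul_assoc, PowerSeries.coeff_C_mul,
    PowerSeries.coeff_X_pow_mul', PowerSeries.coeff_one, if_neg (show ¬m + 1 = 0 by omega)] at h1
  split_ifs with h2
  · rw [if_neg (by omega)] at h1
    simpa [ha.ne'] using h1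
  · rw [if_pos (by omega), genSeries, PowerSeries.coeff_mk] at h1
    field_simp
    linarith

theorem genFlow_zero (hn : 1 ≤ n) (m : ℕ) :
    genFlow a τ r z m 0 = (genPoly a τ r m).eval z := by
  simp [genFlow, partialSeries, genSeries, show 0 < n by omega]

theorem genFlow_cyclicFlow (hn : 1 ≤ n) (hr : 1 ≤ r) (ha : 0 < a) (hτ : ∀ k, 0 < τ k) :
    CyclicFlow n r (extendOne τ) (z / a) (genFlow a τ r z) where
  filter m i hi := by
    have h : extendOne τ i * PowerSeries.coeff (m + 1) (partialSeries a τ r z i) =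
        PowerSeries.coeff m (partialSeries a τ r z i) +
          PowerSeries.coeff (m + 1) (partialSeries a τ r z (i + 1)) := by
      rw [partialSeries_succ, sub_mul, map_sub, PowerSeries.coeff_C_mul,
        PowerSeries.coeff_succ_X_mul]
      ring
    simp only [genFlow, if_pos hi, h]
    congr 1
    split_ifs with h1 h2
    · rfl
    · obtain rfl : n = i + 1 := by omega
      rw [coeff_partialSeries_last ha hτ hr, if_pos (by omega)]
    · obtain rfl : n = i + 1 := by omega
      rw [coeff_partialSeries_last ha hτ hr, if_neg (by omega),
        show m + 1 + (i + 1) - (i + 1) - r = m + 1 - r by omega]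
  delay m i h1 h2 := by
    simp only [genFlow]
    rw [if_neg (show ¬i < n by omega), if_neg (show ¬i + 1 < n by omega),
      show m + 1 + i = m + (i + 1) by ring]
  feedback m := by
    rw [genFlow_zero hn, genFlow, if_neg (by omega), if_neg (by omega),
      show m + (n + r) - n - r = m by omega]
  init_pos i hi := by
    rw [genFlow, if_pos hi, coeff_zero_partialSeries]
    exact mul_pos (Finset.prod_pos fun j _ => extendOne_pos hτ j) (eval_genPoly_zero_pos ha hτ hr)
  init_zero i h1 h2 := by
    rw [genFlow, if_neg (by omega), if_pos (by omega)]

theorem genFlow_init (i : ℕ) (hi : i + 1 < n) :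
    extendOne τ i * genFlow a τ r z 0 i = genFlow a τ r z 0 (i + 1) := by
  rw [genFlow, genFlow, if_pos (by omega), if_pos hi, coeff_zero_partialSeries,
    coeff_zero_partialSeries, Finset.prod_range_succ]
  ring

theorem genFlow_init_last (hn : 1 ≤ n) (hr : 1 ≤ r) (ha : 0 < a) (hτ : ∀ k, 0 < τ k) :
    extendOne τ (n - 1) * genFlow a τ r z 0 (n - 1) = a⁻¹ := by
  rw [genFlow, if_pos (by omega), coeff_zero_partialSeries,
    ← coeff_zero_partialSeries_eq (z := z) ha hτ hr]
  have h := Finset.prod_range_succ (extendOne τ) (n - 1)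
  rw [show n - 1 + 1 = n by omega] at h
  rw [h]; ring

/-- The degree of `H_m` is at most `m / r`. -/
theorem natDegree_genPoly_le (ha : 0 < a) (hτ : ∀ k, 0 < τ k) (hr : 1 ≤ r) (m : ℕ) :
    (genPoly a τ r m).natDegree ≤ m / r := by
  induction m using Nat.strong_induction_on with
  | _ m ih =>
    have hr0 : r ≠ 0 := by omega
    have h := denomSeries_mul_mk_genPoly ha hτ hr
    have h1 := congrArg (PowerSeries.coeff m) h
    rw [denomSeries, add_mul, map_add, mul_assoc, PowerSeries.coeff_C_mul,
      PowerSeries.coeff_X_pow_mul', PowerSeries.coeff_mul,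
      Finset.Nat.sum_antidiagonal_eq_sum_range_succ_mk, Finset.sum_range_succ',
      PowerSeries.coeff_mk] at h1
    simp only [Polynomial.coeff_coe, Polynomial.coeff_map, PowerSeries.coeff_mk, Nat.sub_zero] at h1
    have h0 : (rootPoly a τ).coeff 0 ≠ 0 := by
      rw [rootPoly, Polynomial.coeff_zero_eq_eval_zero, eval_mul, eval_prod]
      simp only [eval_C, eval_sub, eval_X, sub_zero]
      exact (mul_pos ha (Finset.prod_pos fun k _ => hτ k)).ne'
    -- Recurrence for H_m: only the term z H_{m-r} raises the degree, by one for each shift by `r`.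
    have h2 : C ((rootPoly a τ).coeff 0) * genPoly a τ r m =
        PowerSeries.coeff m (1 : PowerSeries ℝ[X]) -
          ∑ k ∈ Finset.range m, C ((rootPoly a τ).coeff (k + 1)) * genPoly a τ r (m - (k + 1)) -
          X * (if r ≤ m then genPoly a τ r (m - r) else 0) := by
      rw [← h1]; ring
    rw [← natDegree_C_mul h0, h2]
    refine (natDegree_sub_le_of_le (natDegree_sub_le_of_le (m := 0) (n := m / r) ?_ ?_) le_rfl).trans
      (max_le (by simp) ?_)
    · rw [PowerSeries.coeff_one]; split_ifs <;> simp
    · refine natDegree_sum_le_of_forall_le _ _ fun k hk => ?_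
      rw [Finset.mem_range] at hk
      exact (natDegree_C_mul_le _ _).trans ((ih _ (by omega)).trans
        (Nat.div_le_div_right (by omega)))
    · split_ifs with h3
      · refine (natDegree_mul_le.trans (add_le_add_left natDegree_X_le _)).trans ?_
        rw [Nat.div_eq_sub_div (by omega) h3, add_comm]
        exact Nat.add_le_add_right (ih _ (by omega)) 1
      · simp

end

/-! ### Geometry of the angles, reality of z(θ), and Q as a rescaled denominator. -/

namespace IsAngleTuple

variable {n r : ℕ} {τ : Fin n → ℝ} {θ s : ℝ} {ϑ : Fin n → ℝ}

theorem lt_pi (hr : 1 ≤ r) (hθ : θ ∈ Set.Ioo 0 (π / r)) : θ < π := by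
  have h1 : (1 : ℝ) ≤ r := by exact_mod_cast hr
  exact hθ.2.trans_le (div_le_self pi_pos.le h1)

theorem sin_pos (h : IsAngleTuple τ r θ ϑ s) (hθ : 0 < θ) (k : Fin n) : 0 < sin (ϑ k) :=
  sin_pos_of_pos_of_lt_pi (hθ.trans (h.lower k)) (h.upper k)

theorem sin_sub_pos (h : IsAngleTuple τ r θ ϑ s) (hθ : 0 < θ) (k : Fin n) : 0 < sin (ϑ k - θ) :=
  sin_pos_of_pos_of_lt_pi (sub_pos.2 (h.lower k)) (by linarith [h.upper k])

theorem modulus_pos (h : IsAngleTuple τ r θ ϑ s) (hn : 1 ≤ n) (hτ : ∀ k, 0 < τ k) (hθ : 0 < θ) :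
    0 < s := by
  rw [← h.ratio ⟨0, hn⟩]
  exact mul_pos (hτ _) (div_pos (h.sin_pos hθ _) (h.sin_sub_pos hθ _))

theorem root_eq (h : IsAngleTuple τ r θ ϑ s) (hθ : 0 < θ) (k : Fin n) :
    τ k = s * sin (ϑ k - θ) / sin (ϑ k) := by
  rw [← h.ratio k]
  have := (h.sin_pos hθ k).ne'
  have := (h.sin_sub_pos hθ k).ne'
  field_simp

/-- Law of sines in the triangle 0, τₖ, s e^{iθ}: the ratio condition makes θₖ the argument of s
e^{iθ} - τₖ. -/
theorem root_sub (h : IsAngleTuple τ r θ ϑ s) (hθ : 0 < θ) (k : Fin n) :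
    (τ k : ℂ) - s * Complex.exp (θ * Complex.I) =
      (s * sin θ / sin (ϑ k) : ℝ) * Complex.exp (-(π - ϑ k : ℝ) * Complex.I) := by
  have h1 := (h.sin_pos hθ k).ne'
  have e : (-(π - ϑ k : ℝ) : ℂ) * Complex.I = (ϑ k - π : ℝ) * Complex.I := by push_cast; ring
  rw [e]
  apply Complex.ext
  · rw [Complex.sub_re, Complex.re_ofReal_mul, Complex.re_ofReal_mul, Complex.exp_ofReal_mul_I_re,
      Complex.exp_ofReal_mul_I_re, Complex.ofReal_re, h.root_eq hθ k, cos_sub_pi, sin_sub]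
    field_simp
    ring
  · rw [Complex.sub_im, Complex.im_ofReal_mul, Complex.im_ofReal_mul, Complex.exp_ofReal_mul_I_im,
      Complex.exp_ofReal_mul_I_im, Complex.ofReal_im, sin_sub_pi]
    field_simp
    ring

end IsAngleTuple

/-- The real number `z(θ)`, in terms of the angles. -/
noncomputable def zReal {n : ℕ} (a : ℝ) (τ : Fin n → ℝ) (r : ℕ) (θ : ℝ) : ℝ :=
  a * (∏ k, modulus τ r θ * sin θ / sin (angles τ r θ k)) / modulus τ r θ ^ r

section

variable {n r : ℕ} {a : ℝ} {τ : Fin n → ℝ} {θ : ℝ}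

theorem modulus_pos (hn : 1 ≤ n) (hr : 1 ≤ r) (hnr : 1 < max n r) (hτ : ∀ k, 0 < τ k)
    (hθ : θ ∈ Set.Ioo 0 (π / r)) : 0 < modulus τ r θ :=
  (isAngleTuple_angles hn hr hnr hτ hθ).modulus_pos hn hτ hθ.1

theorem zReal_pos (hn : 1 ≤ n) (hr : 1 ≤ r) (hnr : 1 < max n r) (ha : 0 < a) (hτ : ∀ k, 0 < τ k)
    (hθ : θ ∈ Set.Ioo 0 (π / r)) : 0 < zReal a τ r θ := by
  have h := isAngleTuple_angles hn hr hnr hτ hθ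
  have hs := modulus_pos hn hr hnr hτ hθ
  have hS := sin_pos_of_pos_of_lt_pi hθ.1 (IsAngleTuple.lt_pi hr hθ)
  exact div_pos (mul_pos ha (Finset.prod_pos fun k _ =>
    div_pos (mul_pos hs hS) (h.sin_pos hθ.1 k))) (pow_pos hs r)

theorem conj_tZero : (starRingEnd ℂ) (tZero τ r θ) =
    modulus τ r θ * Complex.exp (θ * Complex.I) := by
  rw [tZero, map_mul, Complex.conj_ofReal, ← Complex.exp_conj]
  simp

theorem aeval_rootPoly_conj_tZero (hn : 1 ≤ n) (hr : 1 ≤ r) (hnr : 1 < max n r)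
    (hτ : ∀ k, 0 < τ k) (hθ : θ ∈ Set.Ioo 0 (π / r)) :
    aeval ((starRingEnd ℂ) (tZero τ r θ)) (rootPoly a τ) =
      -(zReal a τ r θ : ℂ) * (starRingEnd ℂ) (tZero τ r θ) ^ r := by
  have h := isAngleTuple_angles hn hr hnr hτ hθ
  have hs := modulus_pos hn hr hnr hτ hθ
  have h1 : aeval ((starRingEnd ℂ) (tZero τ r θ)) (rootPoly a τ) =
      a * ∏ k, ((τ k : ℂ) - modulus τ r θ * Complex.exp (θ * Complex.I)) := by
    rw [rootPoly, map_mul, map_prod, aeval_C, conj_tZero]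
    simp
  have h2 : ∑ k, (-(π - angles τ r θ k : ℝ) : ℂ) * Complex.I =
      ((r * θ : ℝ) : ℂ) * Complex.I - π * Complex.I := by
    rw [← Finset.sum_mul, ← sub_mul]
    congr 1
    rw [Finset.sum_neg_distrib, ← Complex.ofReal_sum, Finset.sum_sub_distrib, h.sum_eq]
    simp
    ring
  rw [h1, Finset.prod_congr rfl fun k _ => h.root_sub hθ.1 k, Finset.prod_mul_distrib,
    ← Complex.exp_sum, h2, Complex.exp_sub, Complex.exp_pi_mul_I, conj_tZero, mul_pow,
    ← Complex.exp_nat_mul, zReal]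
  have hs' : (modulus τ r θ : ℂ) ≠ 0 := by exact_mod_cast hs.ne'
  push_cast
  rw [show (r : ℂ) * (θ * Complex.I) = r * θ * Complex.I by ring]
  field_simp

theorem tZero_ne_zero (hn : 1 ≤ n) (hr : 1 ≤ r) (hnr : 1 < max n r)
    (hτ : ∀ k, 0 < τ k) (hθ : θ ∈ Set.Ioo 0 (π / r)) : tZero τ r θ ≠ 0 := by
  rw [tZero]
  exact mul_ne_zero (by exact_mod_cast (modulus_pos hn hr hnr hτ hθ).ne') (Complex.exp_ne_zero _)

theorem aeval_rootPoly_tZero (hn : 1 ≤ n) (hr : 1 ≤ r) (hnr : 1 < max n r)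
    (hτ : ∀ k, 0 < τ k) (hθ : θ ∈ Set.Ioo 0 (π / r)) :
    aeval (tZero τ r θ) (rootPoly a τ) = -(zReal a τ r θ : ℂ) * tZero τ r θ ^ r := by
  have h := congrArg (starRingEnd ℂ) (aeval_rootPoly_conj_tZero (a := a) hn hr hnr hτ hθ)
  rw [← Complex.conjAe_coe, ← Polynomial.aeval_algHom_apply] at h
  simpa using h

theorem zFun_eq (hn : 1 ≤ n) (hr : 1 ≤ r) (hnr : 1 < max n r)
    (hτ : ∀ k, 0 < τ k) (hθ : θ ∈ Set.Ioo 0 (π / r)) : zFun a τ r θ = zReal a τ r θ := by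
  have h0 := pow_ne_zero r (tZero_ne_zero hn hr hnr hτ hθ)
  rw [zFun, aeval_rootPoly_tZero hn hr hnr hτ hθ]
  field_simp

/-- The signs of `H_m(z(θ))` in terms of the position of `θ` with respect to the points
`hπ / (m + r)`. -/
theorem sign_eval_genPoly (hn : 1 ≤ n) (hr : 1 ≤ r) (hnr : 1 < max n r) (ha : 0 < a)
    (hτ : ∀ k, 0 < τ k) (hθ : θ ∈ Set.Ioo 0 (π / r)) {m h : ℕ} {κ : ℝ} (hκ0 : 0 ≤ κ) (hκ1 : κ < 1)
    (hκ : 0 < κ ∨ (n, r) ≠ (2, 1)) (hh : (m + r + κ) * θ = h * π) :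
    (-1) ^ h * (genPoly a τ r m).eval (zReal a τ r θ) < 0 := by
  have hA := isAngleTuple_angles hn hr hnr hτ hθ
  have hs := modulus_pos hn hr hnr hτ hθ
  have hS := sin_pos_of_pos_of_lt_pi hθ.1 (IsAngleTuple.lt_pi hr hθ)
  rw [← genFlow_zero hn]
  refine (genFlow_cyclicFlow (z := zReal a τ r θ) hn hr ha hτ).sign hn hr hnr
    (extendOne_pos hτ) (div_pos (zReal_pos hn hr hnr ha hτ hθ) ha) (inv_pos.2 ha)
    genFlow_init (genFlow_init_last hn hr ha hτ) hs hθ.1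
    (α := extendOne fun k => π - angles τ r θ k)
    (ρ := extendOne fun k => modulus τ r θ * sin θ / sin (angles τ r θ k))
    (extendOne_pos fun k => sub_pos.2 (hA.upper k))
    (extendOne_pos fun k => div_pos (mul_pos hs hS) (hA.sin_pos hθ.1 k)) ?_ (fun j hj => ?_) ?_
    hκ0 hκ1 hκ hh
  · rw [← Fin.sum_univ_eq_sum_range]
    simp only [extendOne_fin, Finset.sum_sub_distrib, hA.sum_eq]
    simp
    ring
  · simp only [extendOne, dif_pos hj]
    exact hA.root_sub hθ.1 ⟨j, hj⟩
  · rw [← Fin.prod_univ_eq_prod_range]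
    simp only [extendOne_fin, zReal]
    field_simp

/-- `Q` is, up to a factor, the denominator `P(t) + z t ^ r` in the variable `t / τ(θ)`. -/
theorem qPoly_eq (hn : 1 ≤ n) (hr : 1 ≤ r) (hnr : 1 < max n r)
    (hτ : ∀ k, 0 < τ k) (hθ : θ ∈ Set.Ioo 0 (π / r)) :
    C (zReal a τ r θ * modulus τ r θ ^ r) * qPoly τ r θ =
      (rootPoly a τ).comp (C (modulus τ r θ) * X) +
        C (zReal a τ r θ * modulus τ r θ ^ r) * X ^ r := by
  have h := isAngleTuple_angles hn hr hnr hτ hθ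
  have hs := modulus_pos hn hr hnr hτ hθ
  have hS := sin_pos_of_pos_of_lt_pi hθ.1 (IsAngleTuple.lt_pi hr hθ)
  have h1 : zReal a τ r θ * modulus τ r θ ^ r =
      a * ∏ k, modulus τ r θ * sin θ / sin (angles τ r θ k) := by
    rw [zReal]; field_simp
  rw [qPoly, mul_add]
  congr 1
  rw [h1, rootPoly, mul_comp, C_comp, prod_comp, C_mul, map_prod, mul_assoc,
    ← Finset.prod_mul_distrib]
  congr 1
  refine Finset.prod_congr rfl fun k _ => ?_
  have h3 := (h.sin_pos hθ.1 k).ne'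
  rw [sub_comp, C_comp, X_comp, mul_sub, ← C_mul, ← mul_assoc, ← C_mul]
  congr 2
  · rw [h.root_eq hθ.1 k]; field_simp
  · congr 1; field_simp

end

/-! ### Partial fractions and the closed form of H(θ). -/

/-- Partial fractions: the coefficients of `-1 / Q` as sums over the simple zeros of `Q`. -/
theorem coe_mul_mk_sum_roots {K : Type*} [Field K] [IsAlgClosed K] {Q : K[X]} (h0 : Q.eval 0 ≠ 0)
    (hnodup : Q.roots.Nodup) (hroots : Q.roots ≠ 0) :
    (Q : PowerSeries K) * PowerSeries.mk (fun m =>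
      (Q.roots.map fun ζ => 1 / (ζ ^ (m + 1) * (derivative Q).eval ζ)).sum) = -1 := by
  classical
  have hQ0 : Q ≠ 0 := by rintro rfl; simp at h0
  set S := Q.roots.toFinset with hS
  have hval : S.val = Q.roots := by rw [hS, Multiset.toFinset_val, hnodup.dedup]
  have hprod : Q = C Q.leadingCoeff * Lagrange.nodal S id := by
    conv_lhs => rw [(IsAlgClosed.splits Q).eq_prod_roots, ← hval]
    rfl
  have hmem : ∀ ζ ∈ S, ζ ≠ 0 := by
    rintro ζ hζ rfl
    exact h0 ((mem_roots hQ0).1 (Multiset.mem_toFinset.1 hζ))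
  have hsum : ∀ m, (Q.roots.map fun ζ => 1 / (ζ ^ (m + 1) * (derivative Q).eval ζ)).sum =
      ∑ ζ ∈ S, 1 / (ζ ^ (m + 1) * (derivative Q).eval ζ) := fun m => by
    rw [Finset.sum, hval]
  have hgeom : ∀ ζ : K, ζ ≠ 0 → (PowerSeries.X - PowerSeries.C ζ) *
      PowerSeries.mk (fun m => 1 / ζ ^ (m + 1)) = -1 := fun ζ hζ => by
    ext m
    rw [sub_mul, map_sub, PowerSeries.coeff_C_mul, PowerSeries.coeff_mk]
    cases m with
    | zero => simp [hζ]
    | succ m =>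
      rw [PowerSeries.coeff_succ_X_mul, PowerSeries.coeff_mk, map_neg, PowerSeries.coeff_one,
        if_neg (by omega)]
      field_simp
      ring
  have hmk : PowerSeries.mk (fun m =>
      (Q.roots.map fun ζ => 1 / (ζ ^ (m + 1) * (derivative Q).eval ζ)).sum) =
      ∑ ζ ∈ S, PowerSeries.C ((derivative Q).eval ζ)⁻¹ *
        PowerSeries.mk (fun m => 1 / ζ ^ (m + 1)) := by
    ext m
    simp only [PowerSeries.coeff_mk, hsum, map_sum, PowerSeries.coeff_C_mul]
    refine Finset.sum_congr rfl fun ζ _ => ?_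
    rw [one_div, one_div, mul_inv, mul_comm]
  have hlead : Q.leadingCoeff ≠ 0 := leadingCoeff_ne_zero.2 hQ0
  -- The quotient Q / ((X - ζ) Q'(ζ)) is the Lagrange basis polynomial at ζ, and over a nonempty set
  -- of nodes these polynomials add up to 1.
  have hterm : ∀ ζ ∈ S, (Q : PowerSeries K) * (PowerSeries.C ((derivative Q).eval ζ)⁻¹ *
      PowerSeries.mk (fun m => 1 / ζ ^ (m + 1))) =
      -((Lagrange.basis S id ζ : K[X]) : PowerSeries K) := fun ζ hζ => by
    have e1 : (derivative Q).eval ζ =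
        Q.leadingCoeff * (Lagrange.nodalWeight S id ζ)⁻¹ := by
      rw [Lagrange.nodalWeight_eq_eval_derivative_nodal hζ, inv_inv]
      conv_lhs => rw [hprod, derivative_C_mul, eval_C_mul]
      rfl
    have e2 : Q = (X - C ζ) * (C Q.leadingCoeff * Lagrange.nodal (S.erase ζ) id) := by
      conv_lhs => rw [hprod, Lagrange.nodal_eq_mul_nodal_erase hζ]
      simp only [id]
      ring
    have e3 : C ((derivative Q).eval ζ)⁻¹ * (C Q.leadingCoeff * Lagrange.nodal (S.erase ζ) id) =
        Lagrange.basis S id ζ := by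
      rw [Lagrange.basis_eq_prod_sub_inv_mul_nodal_div hζ, ← Lagrange.nodal_erase_eq_nodal_div hζ,
        e1, ← mul_assoc, ← C_mul]
      congr 2
      field_simp
    calc (Q : PowerSeries K) * (PowerSeries.C ((derivative Q).eval ζ)⁻¹ *
          PowerSeries.mk (fun m => 1 / ζ ^ (m + 1)))
        = (((X - C ζ) * (C Q.leadingCoeff * Lagrange.nodal (S.erase ζ) id) : K[X]) : PowerSeries K) *
            (PowerSeries.C ((derivative Q).eval ζ)⁻¹ *
              PowerSeries.mk (fun m => 1 / ζ ^ (m + 1))) := by rw [← e2]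
      _ = (PowerSeries.C ((derivative Q).eval ζ)⁻¹ *
            ((C Q.leadingCoeff * Lagrange.nodal (S.erase ζ) id : K[X]) : PowerSeries K)) *
          ((PowerSeries.X - PowerSeries.C ζ) * PowerSeries.mk (fun m => 1 / ζ ^ (m + 1))) := by
        rw [Polynomial.coe_mul, Polynomial.coe_sub, Polynomial.coe_X, Polynomial.coe_C]; ring
      _ = -((Lagrange.basis S id ζ : K[X]) : PowerSeries K) := by
        rw [hgeom ζ (hmem ζ hζ), ← e3, Polynomial.coe_mul (C ((derivative Q).eval ζ)⁻¹),
          Polynomial.coe_C]; ring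
  have hSne : S.Nonempty := by
    rw [hS, Multiset.toFinset_nonempty]; exact hroots
  rw [hmk, Finset.mul_sum, Finset.sum_congr rfl hterm, Finset.sum_neg_distrib,
    ← Polynomial.coe_one, ← Lagrange.sum_basis Function.injective_id.injOn hSne]
  simp only [← Polynomial.coeToPowerSeries.ringHom_apply, map_sum]

section

variable {n r : ℕ} {a : ℝ} {τ : Fin n → ℝ} {θ : ℝ}

/-- The real number `-z(θ) τ(θ) ^ (m + r) H_m(z(θ))`. -/
noncomputable def hVal {n : ℕ} (a : ℝ) (τ : Fin n → ℝ) (r m : ℕ) (θ : ℝ) : ℝ :=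
  -(zReal a τ r θ * modulus τ r θ ^ (m + r) * (genPoly a τ r m).eval (zReal a τ r θ))

theorem qPoly_mul_mk_hVal (hn : 1 ≤ n) (hr : 1 ≤ r) (hnr : 1 < max n r) (ha : 0 < a)
    (hτ : ∀ k, 0 < τ k) (hθ : θ ∈ Set.Ioo 0 (π / r)) :
    (qPoly τ r θ : PowerSeries ℝ) * PowerSeries.mk (fun m => hVal a τ r m θ) = -1 := by
  have hz := zReal_pos hn hr hnr ha hτ hθ
  have hs := modulus_pos hn hr hnr hτ hθ
  have h1 := congrArg (PowerSeries.rescale (modulus τ r θ))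
    (denom_mul_genSeries ha hτ hr (zReal a τ r θ))
  have h2 : PowerSeries.rescale (modulus τ r θ) ((rootPoly a τ : PowerSeries ℝ) +
      PowerSeries.C (zReal a τ r θ) * PowerSeries.X ^ r) =
      PowerSeries.C (zReal a τ r θ * modulus τ r θ ^ r) * (qPoly τ r θ : PowerSeries ℝ) := by
    rw [← Polynomial.coe_C (zReal a τ r θ * modulus τ r θ ^ r), ← Polynomial.coe_mul, qPoly_eq hn hr hnr hτ hθ, map_add]
    ext k
    simp only [map_add, PowerSeries.coeff_rescale, Polynomial.coeff_coe, Polynomial.coeff_add,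
      Polynomial.comp_C_mul_X_coeff, PowerSeries.coeff_C_mul, Polynomial.coeff_C_mul,
      PowerSeries.coeff_X_pow, Polynomial.coeff_X_pow]
    split_ifs with h
    · rw [h]; ring
    · ring
  rw [map_mul, map_one, h2, mul_right_comm, mul_comm] at h1
  have h3 : PowerSeries.mk (fun m => hVal a τ r m θ) =
      -(PowerSeries.C (zReal a τ r θ * modulus τ r θ ^ r) *
        PowerSeries.rescale (modulus τ r θ) (genSeries a τ r (zReal a τ r θ))) := by
    ext m
    simp only [PowerSeries.coeff_mk, map_neg, PowerSeries.coeff_C_mul, PowerSeries.coeff_rescale,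
      genSeries, hVal]
    ring
  rw [h3, mul_neg, h1]

theorem coeff_zero_qPoly_ne_zero (hn : 1 ≤ n) (hr : 1 ≤ r) (hnr : 1 < max n r)
    (hτ : ∀ k, 0 < τ k) (hθ : θ ∈ Set.Ioo 0 (π / r)) : (qPoly τ r θ).coeff 0 ≠ 0 := by
  intro h
  have h1 := congrArg PowerSeries.constantCoeff
    (qPoly_mul_mk_hVal (a := 1) hn hr hnr one_pos hτ hθ)
  rw [map_mul, ← PowerSeries.coeff_zero_eq_constantCoeff_apply, Polynomial.coeff_coe, h] at h1
  simp at h1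

theorem aroots_qPoly_ne_zero (hn : 1 ≤ n) (hr : 1 ≤ r) (hnr : 1 < max n r)
    (hτ : ∀ k, 0 < τ k) (hθ : θ ∈ Set.Ioo 0 (π / r)) : (qPoly τ r θ).aroots ℂ ≠ 0 := by
  have hz := zReal_pos hn hr hnr one_pos hτ hθ
  have hs := modulus_pos hn hr hnr hτ hθ
  -- The number e^{iθ}, the conjugate of t₀ divided by τ(θ), is a zero of Q.
  have h1 := congrArg (aeval (Complex.exp (θ * Complex.I))) (qPoly_eq (a := 1) hn hr hnr hτ hθ)
  have h2 := aeval_rootPoly_conj_tZero (a := 1) hn hr hnr hτ hθ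
  rw [conj_tZero] at h2
  simp only [map_mul, map_add, aeval_comp, aeval_C, map_pow, aeval_X, Complex.coe_algebraMap, h2] at h1
  have h3 : aeval (Complex.exp (θ * Complex.I)) (qPoly τ r θ) = 0 := by
    have hz' : (zReal 1 τ r θ : ℂ) ≠ 0 := by exact_mod_cast hz.ne'
    have hs' : (modulus τ r θ : ℂ) ≠ 0 := by exact_mod_cast hs.ne'
    refine (mul_eq_zero.1 (h1.trans ?_)).resolve_left (mul_ne_zero hz' (pow_ne_zero r hs'))
    ring
  intro h4
  have hq : qPoly τ r θ ≠ 0 := fun h => coeff_zero_qPoly_ne_zero hn hr hnr hτ hθ (by simp [h])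
  have h5 := (mem_aroots.2 ⟨hq, h3⟩)
  rw [h4] at h5
  exact Multiset.notMem_zero _ h5

theorem hSum_eq (hn : 1 ≤ n) (hr : 1 ≤ r) (hnr : 1 < max n r) (ha : 0 < a)
    (hτ : ∀ k, 0 < τ k) (hθ : θ ∈ Set.Ioo 0 (π / r)) (hnodup : ((qPoly τ r θ).aroots ℂ).Nodup)
    (m : ℕ) : hSum τ r m θ = hVal a τ r m θ := by
  have h0 := coeff_zero_qPoly_ne_zero hn hr hnr hτ hθ
  set Q : ℂ[X] := (qPoly τ r θ).map (algebraMap ℝ ℂ) with hQ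
  have hQ0 : Q.eval 0 ≠ 0 := by
    rw [← Polynomial.coeff_zero_eq_eval_zero, hQ, Polynomial.coeff_map]
    simpa using h0
  have h1 := coe_mul_mk_sum_roots hQ0 hnodup (aroots_qPoly_ne_zero hn hr hnr hτ hθ)
  have h2 := congrArg (PowerSeries.map (algebraMap ℝ ℂ)) (qPoly_mul_mk_hVal hn hr hnr ha hτ hθ)
  rw [map_mul, map_neg, map_one, ← Polynomial.polynomial_map_coe, ← hQ, ← h1] at h2
  have hQne : (Q : PowerSeries ℂ) ≠ 0 := by
    rw [Ne, Polynomial.coe_eq_zero_iff]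
    rintro h; rw [h] at hQ0; simp at hQ0
  have h3 := congrArg (PowerSeries.coeff m) (mul_left_cancel₀ hQne h2)
  simp only [PowerSeries.coeff_map, PowerSeries.coeff_mk] at h3
  rw [hSum]
  simp only [aeval_def, ← eval_map, ← derivative_map]
  exact h3.symm

end

/-! ### Continuity and injectivity of z(θ); the exceptional set where Q has multiple zeros. -/

section

variable {n r : ℕ} {a : ℝ} {τ : Fin n → ℝ} {θ : ℝ}

theorem angles_eq_angleOf (hn : 1 ≤ n) (hr : 1 ≤ r) (hnr : 1 < max n r) (hτ : ∀ k, 0 < τ k)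
    (hθ : θ ∈ Set.Ioo 0 (π / r)) (k : Fin n) :
    angles τ r θ k = angleOf (τ k) θ (modulus τ r θ) := by
  have h := isAngleTuple_angles hn hr hnr hτ hθ
  exact (eq_angleOf (hτ k) hθ.1 (h.lower k) (h.upper k) (h.ratio k)).2

theorem continuousAt_angleOf {t s : ℝ} (hθ0 : 0 < θ) (hθ1 : θ < π) (hs : 0 < s) :
    ContinuousAt (fun θ => angleOf t θ s) θ := by
  have hS := sin_pos_of_pos_of_lt_pi hθ0 hθ1
  unfold angleOf
  refine continuousAt_const.sub (continuous_arctan.continuousAt.comp ?_)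
  exact ContinuousAt.div (by fun_prop) (by fun_prop) (mul_pos hs hS).ne'

theorem sum_angleOf_lt {θ s s' : ℝ} (hn : 1 ≤ n) (hτ : ∀ k, 0 < τ k) (h0 : 0 < θ) (h1 : θ < π)
    (hs : 0 < s) (hss : s < s') : ∑ k, angleOf (τ k) θ s' < ∑ k, angleOf (τ k) θ s :=
  Finset.sum_lt_sum_of_nonempty ⟨⟨0, hn⟩, Finset.mem_univ _⟩ fun k _ =>
    angleOf_lt (hτ k) h0 h1 hs hss

theorem sum_angleOf_modulus (hn : 1 ≤ n) (hr : 1 ≤ r) (hnr : 1 < max n r) (hτ : ∀ k, 0 < τ k)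
    (hθ : θ ∈ Set.Ioo 0 (π / r)) :
    ∑ k, angleOf (τ k) θ (modulus τ r θ) = r * θ + ((n : ℝ) - 1) * π := by
  rw [← (isAngleTuple_angles hn hr hnr hτ hθ).sum_eq]
  exact Finset.sum_congr rfl fun k _ => (angles_eq_angleOf hn hr hnr hτ hθ k).symm

/-- The angle sum is strictly decreasing in the modulus. Comparing `modulus τ r x` with a fixed `b`
therefore amounts to a sign condition on a function continuous in `x`. -/
theorem continuousAt_modulus (hn : 1 ≤ n) (hr : 1 ≤ r) (hnr : 1 < max n r) (hτ : ∀ k, 0 < τ k)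
    (hθ : θ ∈ Set.Ioo 0 (π / r)) : ContinuousAt (modulus τ r) θ := by
  have hI : ∀ᶠ x in 𝓝 θ, x ∈ Set.Ioo 0 (π / r) := Ioo_mem_nhds hθ.1 hθ.2
  have hs := modulus_pos hn hr hnr hτ hθ
  have hπ := IsAngleTuple.lt_pi hr hθ
  have hcont : ∀ b, 0 < b → ContinuousAt
      (fun x => ∑ k, angleOf (τ k) x b - (r * x + ((n : ℝ) - 1) * π)) θ := fun b hb =>
    ContinuousAt.sub (tendsto_finsetSum _ fun k _ => continuousAt_angleOf hθ.1 hπ hb)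
      (by fun_prop)
  have hsum := sum_angleOf_modulus hn hr hnr hτ hθ
  refine tendsto_order.2 ⟨fun b hb => ?_, fun b hb => ?_⟩
  · have hb' : max b (modulus τ r θ / 2) < modulus τ r θ := max_lt hb (by linarith)
    have hb0 : 0 < max b (modulus τ r θ / 2) := lt_max_of_lt_right (by linarith)
    have h1 := sum_angleOf_lt hn hτ hθ.1 hπ hb0 hb'
    filter_upwards [hI, (hcont _ hb0).eventually_const_lt (u := 0) (by linarith)] with x hx hx'
    refine (le_max_left b (modulus τ r θ / 2)).trans_lt (not_le.1 fun hcon => ?_)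
    have h2 := sum_angleOf_modulus hn hr hnr hτ hx
    rcases hcon.eq_or_lt with h | h
    · rw [h] at h2; linarith
    · have := sum_angleOf_lt hn hτ hx.1 (IsAngleTuple.lt_pi hr hx)
        (modulus_pos hn hr hnr hτ hx) h
      linarith
  · have hb0 : 0 < b := hs.trans hb
    have h1 := sum_angleOf_lt hn hτ hθ.1 hπ hs hb
    filter_upwards [hI, (hcont _ hb0).eventually_lt_const (u := 0) (by linarith)] with x hx hx'
    refine not_le.1 fun hcon => ?_
    have h2 := sum_angleOf_modulus hn hr hnr hτ hx
    rcases hcon.eq_or_lt with h | h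
    · rw [← h] at h2; linarith
    · have := sum_angleOf_lt hn hτ hx.1 (IsAngleTuple.lt_pi hr hx) hb0 h
      linarith

theorem continuousAt_tZero (hn : 1 ≤ n) (hr : 1 ≤ r) (hnr : 1 < max n r) (hτ : ∀ k, 0 < τ k)
    (hθ : θ ∈ Set.Ioo 0 (π / r)) : ContinuousAt (tZero τ r) θ := by
  unfold tZero
  exact (Complex.continuous_ofReal.continuousAt.comp (continuousAt_modulus hn hr hnr hτ hθ)).mul
    (by fun_prop)

theorem continuousOn_zReal (hn : 1 ≤ n) (hr : 1 ≤ r) (hnr : 1 < max n r) (hτ : ∀ k, 0 < τ k) :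
    ContinuousOn (zReal a τ r) (Set.Ioo 0 (π / r)) := by
  have h1 : ContinuousOn (fun θ => (zFun a τ r θ).re) (Set.Ioo 0 (π / r)) := fun θ hθ => by
    refine (Complex.continuous_re.continuousAt.comp ?_).continuousWithinAt
    have ht := continuousAt_tZero hn hr hnr hτ hθ
    exact ContinuousAt.div ((Polynomial.continuous_aeval _).continuousAt.comp ht).neg
      (ht.pow r) (pow_ne_zero r (tZero_ne_zero hn hr hnr hτ hθ))
  exact h1.congr fun θ hθ => by
    simp only [zFun_eq hn hr hnr hτ hθ, Complex.ofReal_re]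

theorem continuousOn_hVal (hn : 1 ≤ n) (hr : 1 ≤ r) (hnr : 1 < max n r) (hτ : ∀ k, 0 < τ k)
    (m : ℕ) : ContinuousOn (hVal a τ r m) (Set.Ioo 0 (π / r)) := by
  have hz := continuousOn_zReal (a := a) hn hr hnr hτ
  have hs : ContinuousOn (modulus τ r) (Set.Ioo 0 (π / r)) := fun θ hθ =>
    (continuousAt_modulus hn hr hnr hτ hθ).continuousWithinAt
  exact ((hz.mul (hs.pow _)).mul ((Polynomial.continuous _).comp_continuousOn hz)).neg

theorem tZero_im_neg (hn : 1 ≤ n) (hr : 1 ≤ r) (hnr : 1 < max n r) (hτ : ∀ k, 0 < τ k)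
    (hθ : θ ∈ Set.Ioo 0 (π / r)) : (tZero τ r θ).im < 0 := by
  have hs := modulus_pos hn hr hnr hτ hθ
  have hS := sin_pos_of_pos_of_lt_pi hθ.1 (IsAngleTuple.lt_pi hr hθ)
  rw [tZero, Complex.im_ofReal_mul, ← neg_mul, ← Complex.ofReal_neg, Complex.exp_ofReal_mul_I_im,
    sin_neg]
  nlinarith [mul_pos hs hS]

theorem injOn_tZero (hn : 1 ≤ n) (hr : 1 ≤ r) (hnr : 1 < max n r) (hτ : ∀ k, 0 < τ k) :
    Set.InjOn (tZero τ r) (Set.Ioo 0 (π / r)) := by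
  intro x hx y hy hxy
  have hsx := modulus_pos hn hr hnr hτ hx
  have hsy := modulus_pos hn hr hnr hτ hy
  have h1 := congrArg norm hxy
  have h2 : ∀ θ : ℝ, -((θ : ℂ) * Complex.I) = ((-θ : ℝ) : ℂ) * Complex.I := fun θ => by
    push_cast; ring
  simp only [tZero, h2] at hxy h1
  rw [norm_mul, norm_mul, Complex.norm_exp_ofReal_mul_I, Complex.norm_exp_ofReal_mul_I, mul_one,
    mul_one, Complex.norm_of_nonneg hsx.le, Complex.norm_of_nonneg hsy.le] at h1
  have h3 := congrArg Complex.re hxy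
  rw [h1, Complex.re_ofReal_mul, Complex.re_ofReal_mul, Complex.exp_ofReal_mul_I_re,
    Complex.exp_ofReal_mul_I_re, cos_neg, cos_neg] at h3
  exact injOn_cos ⟨hx.1.le, (IsAngleTuple.lt_pi hr hx).le⟩ ⟨hy.1.le, (IsAngleTuple.lt_pi hr hy).le⟩
    (mul_left_cancel₀ hsy.ne' h3)

theorem aeval_derivative_rootPoly {t : ℂ} (ht : ∀ k, t ≠ τ k) :
    aeval t (derivative (rootPoly a τ)) =
      aeval t (rootPoly a τ) * ∑ k, 1 / (t - τ k) := by
  have key : ∀ S : Finset (Fin n), aeval t (derivative (∏ k ∈ S, (C (τ k) - X))) =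
      aeval t (∏ k ∈ S, (C (τ k) - X)) * ∑ k ∈ S, 1 / (t - τ k) := fun S => by
    classical
    induction S using Finset.induction_on with
    | empty => simp
    | insert k S hk ih =>
      rw [Finset.prod_insert hk, Finset.sum_insert hk, derivative_mul, map_add, map_mul, map_mul,
        ih]
      have := sub_ne_zero.2 (ht k)
      simp
      field_simp
      ring
  rw [rootPoly, derivative_C_mul, map_mul, map_mul, key]
  ring

/-- The critical points of `P(t) / t ^ r` are real. -/
theorem mul_derivative_ne (hn : 1 ≤ n) (hτ : ∀ k, 0 < τ k) {t : ℂ} (ht : t.im < 0)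
    (hP : aeval t (rootPoly a τ) ≠ 0) :
    t * aeval t (derivative (rootPoly a τ)) ≠ r * aeval t (rootPoly a τ) := by
  have htk : ∀ k, t ≠ τ k := fun k h => by rw [h] at ht; simp at ht
  rw [aeval_derivative_rootPoly htk]
  intro h
  have h1 : ∑ k, t / (t - τ k) = r := by
    refine mul_left_cancel₀ hP ?_
    rw [mul_comm _ (r : ℂ), ← h]
    simp only [div_eq_mul_inv, one_mul, ← Finset.mul_sum]
    ring
  -- Each t / (t - τₖ) has imaginary part -τₖ Im t / |t - τₖ|² > 0, so their sum cannot be the real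
  -- number `r`.
  have h2 := congrArg Complex.im h1
  rw [Complex.im_sum, Complex.natCast_im] at h2
  refine (Finset.sum_pos (fun k _ => ?_) ⟨⟨0, hn⟩, Finset.mem_univ _⟩ :
    0 < ∑ k, (t / (t - τ k)).im).ne' h2
  have h3 : 0 < Complex.normSq (t - τ k) := Complex.normSq_pos.2 (sub_ne_zero.2 (htk k))
  rw [Complex.div_im, ← sub_div]
  refine div_pos ?_ h3
  simp only [Complex.sub_re, Complex.sub_im, Complex.ofReal_re, Complex.ofReal_im]
  nlinarith [mul_pos (hτ k) (neg_pos.2 ht)]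

/-- The map t ↦ -P(t)/t^r has nonzero derivative at the nonreal point t₀(θ), hence a local inverse
recovering t₀(θ) from z(θ). Thus z(θ) is locally injective. Two equal values would produce an
interior extremum, impossible for a continuous function that is strictly monotone near each point.
-/
theorem injOn_zReal (hn : 1 ≤ n) (hr : 1 ≤ r) (hnr : 1 < max n r) (ha : 0 < a)
    (hτ : ∀ k, 0 < τ k) : Set.InjOn (zReal a τ r) (Set.Ioo 0 (π / r)) := by
  -- local injectivity
  have hloc : ∀ c ∈ Set.Ioo 0 (π / r), ∃ g : ℂ → ℂ,
      ∀ᶠ x in 𝓝 c, g (zReal a τ r x) = tZero τ r x := by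
    intro c hc
    have ht := tZero_ne_zero hn hr hnr hτ hc
    have hP : aeval (tZero τ r c) (rootPoly a τ) ≠ 0 := by
      rw [aeval_rootPoly_tZero hn hr hnr hτ hc]
      have : (zReal a τ r c : ℂ) ≠ 0 := by exact_mod_cast (zReal_pos hn hr hnr ha hτ hc).ne'
      exact mul_ne_zero (neg_ne_zero.2 this) (pow_ne_zero r ht)
    have hne := mul_derivative_ne (r := r) hn hτ (tZero_im_neg hn hr hnr hτ hc) hP
    have hd : HasStrictDerivAt (fun t : ℂ => -(aeval t (rootPoly a τ)) / t ^ r)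
        ((-(aeval (tZero τ r c) (derivative (rootPoly a τ))) * tZero τ r c ^ r -
          -(aeval (tZero τ r c) (rootPoly a τ)) * (r * tZero τ r c ^ (r - 1))) /
            (tZero τ r c ^ r) ^ 2) (tZero τ r c) :=
      ((rootPoly a τ).hasStrictDerivAt_aeval _).neg.div (hasStrictDerivAt_pow r _)
        (pow_ne_zero r ht)
    have hd0 : (-(aeval (tZero τ r c) (derivative (rootPoly a τ))) * tZero τ r c ^ r -
          -(aeval (tZero τ r c) (rootPoly a τ)) * (r * tZero τ r c ^ (r - 1))) /
            (tZero τ r c ^ r) ^ 2 ≠ 0 := by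
      refine div_ne_zero (fun h => hne ?_) (pow_ne_zero 2 (pow_ne_zero r ht))
      have e : tZero τ r c ^ r = tZero τ r c ^ (r - 1) * tZero τ r c := by
        rw [← pow_succ, Nat.sub_add_cancel hr]
      rw [e] at h
      refine mul_left_cancel₀ (pow_ne_zero (r - 1) ht) ?_
      linear_combination -h
    refine ⟨HasStrictDerivAt.localInverse _ _ _ hd hd0, ?_⟩
    filter_upwards [(continuousAt_tZero hn hr hnr hτ hc).eventually
      (hd.eventually_left_inverse hd0), Ioo_mem_nhds hc.1 hc.2] with x hx hx'
    rw [← zFun_eq hn hr hnr hτ hx']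
    exact hx
  have hcont := continuousOn_zReal (a := a) hn hr hnr hτ
  have main : ∀ x ∈ Set.Ioo 0 (π / r), ∀ y ∈ Set.Ioo 0 (π / r), x < y →
      zReal a τ r x ≠ zReal a τ r y := by
    intro x hx y hy hxy hz
    obtain ⟨c, hc, hext⟩ := exists_isLocalExtr_Ioo hxy
      (hcont.mono (Set.Icc_subset_Ioo hx.1 hy.2)) hz
    have hcI : c ∈ Set.Ioo 0 (π / r) := ⟨hx.1.trans hc.1, hc.2.trans hy.2⟩
    obtain ⟨g, hg⟩ := hloc c hcI
    obtain ⟨l, u, hlu, hsub⟩ := mem_nhds_iff_exists_Ioo_subset.1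
      (hg.and (Ioo_mem_nhds hcI.1 hcI.2))
    have hl' : (l + c) / 2 < c := by linarith [hlu.1]
    have hu' : c < (c + u) / 2 := by linarith [hlu.2]
    have hIcc : Set.Icc ((l + c) / 2) ((c + u) / 2) ⊆ Set.Ioo l u := fun v hv =>
      ⟨by linarith [hv.1, hlu.1], by linarith [hv.2, hlu.2]⟩
    have hinj : Set.InjOn (zReal a τ r) (Set.Icc ((l + c) / 2) ((c + u) / 2)) := by
      intro v hv v' hv' h
      obtain ⟨h1, h2⟩ := hsub (hIcc hv)
      obtain ⟨h1', h2'⟩ := hsub (hIcc hv')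
      refine injOn_tZero hn hr hnr hτ h2 h2' ?_
      rw [← h1, ← h1', h]
    have hc' : ContinuousOn (zReal a τ r) (Set.Icc ((l + c) / 2) ((c + u) / 2)) :=
      hcont.mono fun v hv => (hsub (hIcc hv)).2
    have hcm : c ∈ Set.Icc ((l + c) / 2) ((c + u) / 2) := ⟨hl'.le, hu'.le⟩
    have hR : ∀ p : ℝ → Prop, (∀ᶠ v in 𝓝 c, p v) → ∃ v ∈ Set.Ioo c ((c + u) / 2), p v :=
      fun p hp => (Eventually.and (Ioo_mem_nhdsGT hu')
        (hp.filter_mono nhdsWithin_le_nhds)).exists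
    have hL : ∀ p : ℝ → Prop, (∀ᶠ v in 𝓝 c, p v) → ∃ v ∈ Set.Ioo ((l + c) / 2) c, p v :=
      fun p hp => (Eventually.and (Ioo_mem_nhdsLT hl')
        (hp.filter_mono nhdsWithin_le_nhds)).exists
    rcases hc'.strictMonoOn_of_injOn_Icc' (hl'.trans hu').le hinj with hm | hm <;>
      rcases hext with he | he
    · obtain ⟨v, hv, hv'⟩ := hL _ he
      exact absurd (hm ⟨hv.1.le, hv.2.le.trans hu'.le⟩ hcm hv.2) (not_lt.2 hv')
    · obtain ⟨v, hv, hv'⟩ := hR _ he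
      exact absurd (hm hcm ⟨hl'.le.trans hv.1.le, hv.2.le⟩ hv.1) (not_lt.2 hv')
    · obtain ⟨v, hv, hv'⟩ := hR _ he
      exact absurd (hm hcm ⟨hl'.le.trans hv.1.le, hv.2.le⟩ hv.1) (not_lt.2 hv')
    · obtain ⟨v, hv, hv'⟩ := hL _ he
      exact absurd (hm ⟨hv.1.le, hv.2.le.trans hu'.le⟩ hcm hv.2) (not_lt.2 hv')
  intro x hx y hy h
  rcases lt_trichotomy x y with hlt | heq | hgt
  · exact absurd h (main x hx y hy hlt)
  · exact heq
  · exact absurd h.symm (main y hy x hx hgt)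

/-- The zeros of `Q` are distinct for all but finitely many `θ`. -/
theorem finite_not_nodup (hn : 1 ≤ n) (hr : 1 ≤ r) (hnr : 1 < max n r) (hτ : ∀ k, 0 < τ k) :
    {θ ∈ Set.Ioo 0 (π / r) | ¬((qPoly τ r θ).aroots ℂ).Nodup}.Finite := by
  set P := rootPoly 1 τ with hP
  set D : ℝ[X] := X * derivative P - C (r : ℝ) * P with hD
  have hP0 : P.eval 0 ≠ 0 := by
    rw [hP, rootPoly, eval_mul, eval_prod]
    simp only [eval_C, eval_sub, eval_X, sub_zero]
    exact (mul_pos one_pos (Finset.prod_pos fun k _ => hτ k)).ne'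
  have hD0 : D ≠ 0 := fun h => by
    have h1 := congrArg (eval 0) h
    have hr' : (r : ℝ) ≠ 0 := by exact_mod_cast (by omega : r ≠ 0)
    simp [hD, hP0, hr'] at h1
  refine Set.Finite.of_finite_image (f := fun θ => (zReal 1 τ r θ : ℂ)) ?_ ?_
  · refine ((D.aroots ℂ).toFinset.finite_toSet.image fun t => -(aeval t P) / t ^ r).subset ?_
    rintro _ ⟨θ, ⟨hθ, hnd⟩, rfl⟩
    have hs := modulus_pos hn hr hnr hτ hθ
    have hz := zReal_pos hn hr hnr one_pos hτ hθ
    have hs' : (modulus τ r θ : ℂ) ≠ 0 := by exact_mod_cast hs.ne'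
    have hz' : (zReal 1 τ r θ : ℂ) ≠ 0 := by exact_mod_cast hz.ne'
    have h0 := coeff_zero_qPoly_ne_zero hn hr hnr hτ hθ
    have hQ : qPoly τ r θ ≠ 0 := fun h => h0 (by simp [h])
    have hQ' : (qPoly τ r θ).map (algebraMap ℝ ℂ) ≠ 0 :=
      (Polynomial.map_ne_zero_iff (algebraMap ℝ ℂ).injective).2 hQ
    rw [Multiset.nodup_iff_count_le_one] at hnd
    push Not at hnd
    obtain ⟨ζ, hζ⟩ := hnd
    rw [aroots_def, count_roots, one_lt_rootMultiplicity_iff_isRoot hQ'] at hζ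
    obtain ⟨hζ1, hζ2⟩ := hζ
    rw [derivative_map] at hζ2
    rw [IsRoot.def, eval_map_algebraMap] at hζ1 hζ2
    have e := qPoly_eq (a := 1) hn hr hnr hτ hθ
    obtain ⟨c, hc⟩ : ∃ c, c = zReal 1 τ r θ * modulus τ r θ ^ r := ⟨_, rfl⟩
    have hc' : (c : ℂ) = zReal 1 τ r θ * modulus τ r θ ^ r := by rw [hc]; push_cast; rfl
    rw [← hc] at e
    have e1 := congrArg (aeval ζ) e
    have e2 := congrArg (fun p => aeval ζ (derivative p)) e
    have hζ0 : ζ ≠ 0 := by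
      rintro rfl
      rw [← Polynomial.coeff_zero_eq_aeval_zero'] at hζ1
      simp [h0] at hζ1
    simp only [derivative_mul, derivative_C, zero_mul, zero_add, map_add, derivative_comp,
      derivative_X_pow, derivative_X, mul_one, map_mul, aeval_comp, aeval_C, map_pow,
      aeval_X, Complex.coe_algebraMap, hζ1, hζ2, mul_zero, ← hP, map_natCast] at e1 e2
    have hpow : ζ * ζ ^ (r - 1) = ζ ^ r := by rw [← pow_succ', Nat.sub_add_cancel hr]
    -- Eliminating z from Q(ζ) = Q'(ζ) = 0 shows that τ(θ)ζ is a zero of tP' - rP, and z(θ) is the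
    -- value of -P(t)/t^r there.
    refine ⟨modulus τ r θ * ζ, ?_, ?_⟩
    · rw [Finset.mem_coe, Multiset.mem_toFinset, mem_aroots]
      refine ⟨hD0, ?_⟩
      simp only [hD, map_sub, map_mul, aeval_X, aeval_C, Complex.coe_algebraMap]
      push_cast
      linear_combination (-ζ) * e2 + r * e1 - c * r * hpow
    · simp only
      rw [div_eq_iff (pow_ne_zero r (mul_ne_zero hs' hζ0))]
      rw [hc'] at e1
      linear_combination e1
  · intro x hx y hy h
    exact injOn_zReal hn hr hnr one_pos hτ hx.1 hy.1 (Complex.ofReal_injective h)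

/-- Near `θ`, apart from `θ` itself, the zeros of Q are distinct because the exceptional set is
finite. There the sum agrees with the continuous function `hVal`. -/
theorem tendsto_hSum (hn : 1 ≤ n) (hr : 1 ≤ r) (hnr : 1 < max n r) (ha : 0 < a)
    (hτ : ∀ k, 0 < τ k) (hθ : θ ∈ Set.Ioo 0 (π / r)) (m : ℕ) :
    Tendsto (hSum τ r m) (𝓝[≠] θ) (𝓝 (hVal a τ r m θ : ℂ)) := by
  have hI : Set.Ioo 0 (π / r) ∈ 𝓝 θ := Ioo_mem_nhds hθ.1 hθ.2
  have h1 : Tendsto (fun x => (hVal a τ r m x : ℂ)) (𝓝[≠] θ) (𝓝 (hVal a τ r m θ : ℂ)) :=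
    (Complex.continuous_ofReal.continuousAt.comp
      ((continuousOn_hVal hn hr hnr hτ m).continuousAt hI)).tendsto.mono_left nhdsWithin_le_nhds
  refine h1.congr' ?_
  have hfin := (finite_not_nodup hn hr hnr hτ).subset (Set.sdiff_subset (t := {θ}))
  have h2 := hfin.isClosed.isOpen_compl.mem_nhds (x := θ) (by simp)
  filter_upwards [self_mem_nhdsWithin, nhdsWithin_le_nhds hI, nhdsWithin_le_nhds h2] with x hx hx' hx2
  refine (hSum_eq hn hr hnr ha hτ hx' ?_ m).symm
  by_contra hcon
  exact hx2 ⟨⟨hx', hcon⟩, hx⟩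

theorem hFun_eq (hn : 1 ≤ n) (hr : 1 ≤ r) (hnr : 1 < max n r) (ha : 0 < a)
    (hτ : ∀ k, 0 < τ k) (hθ : θ ∈ Set.Ioo 0 (π / r)) (m : ℕ) : hFun τ r m θ = hVal a τ r m θ := by
  rw [hFun, (tendsto_hSum hn hr hnr ha hτ hθ m).limUnder_eq, Complex.ofReal_re]

end

/-! ### Counting zeros between the sample points. -/

theorem exists_zero_Ioo {f : ℝ → ℝ} {x y : ℝ} (hxy : x < y) (hf : ContinuousOn f (Set.Icc x y))
    (h : f x * f y < 0) : ∃ c ∈ Set.Ioo x y, f c = 0 := by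
  rcases mul_neg_iff.1 h with ⟨h1, h2⟩ | ⟨h1, h2⟩
  · exact intermediate_value_Ioo' hxy.le hf ⟨h2, h1⟩
  · exact intermediate_value_Ioo hxy.le hf ⟨h1, h2⟩

theorem sign_eq_neg_one_pow {v : ℝ} {h : ℕ} (hv : 0 < (-1) ^ h * v) : Real.sign v = (-1) ^ h := by
  rcases neg_one_pow_eq_or ℝ h with e | e <;> rw [e] at hv ⊢
  · exact Real.sign_of_pos (by linarith)
  · exact Real.sign_of_neg (by linarith)

section

variable {n r : ℕ} {a : ℝ} {τ : Fin n → ℝ} {θ : ℝ}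

theorem hVal_eq_zero_iff (hn : 1 ≤ n) (hr : 1 ≤ r) (hnr : 1 < max n r) (ha : 0 < a)
    (hτ : ∀ k, 0 < τ k) (hθ : θ ∈ Set.Ioo 0 (π / r)) (m : ℕ) :
    hVal a τ r m θ = 0 ↔ (genPoly a τ r m).eval (zReal a τ r θ) = 0 := by
  have h := mul_pos (zReal_pos hn hr hnr ha hτ hθ) (pow_pos (modulus_pos hn hr hnr hτ hθ) (m + r))
  rw [hVal, neg_eq_zero, mul_eq_zero, or_iff_right h.ne']

theorem sign_hVal (hn : 1 ≤ n) (hr : 1 ≤ r) (hnr : 1 < max n r) (ha : 0 < a)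
    (hτ : ∀ k, 0 < τ k) (hθ : θ ∈ Set.Ioo 0 (π / r)) {m h : ℕ} {κ : ℝ} (hκ0 : 0 ≤ κ) (hκ1 : κ < 1)
    (hκ : 0 < κ ∨ (n, r) ≠ (2, 1)) (hh : (m + r + κ) * θ = h * π) :
    0 < (-1) ^ h * hVal a τ r m θ := by
  have h1 := sign_eval_genPoly hn hr hnr ha hτ hθ hκ0 hκ1 hκ hh
  have h2 := mul_pos (zReal_pos hn hr hnr ha hτ hθ) (pow_pos (modulus_pos hn hr hnr hτ hθ) (m + r))
  have h3 := mul_pos h2 (neg_pos.2 h1)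
  rw [hVal]
  linarith

/-- Points of `(0, π / r)` slightly to the left of the points `hπ / (m + r)`. -/
noncomputable def samplePoint (r m h : ℕ) : ℝ := h * π / (m + r + 1 / 2)

theorem samplePoint_mem (hr : 1 ≤ r) {m h : ℕ} (h1 : 1 ≤ h) (h2 : h ≤ m / r + 1) :
    samplePoint r m h ∈ Set.Ioo 0 (π / r) := by
  have hr' : (0 : ℝ) < r := by exact_mod_cast hr
  have h1' : (0 : ℝ) < h := by exact_mod_cast h1
  have h3 : h * r ≤ m + r := by
    calc h * r ≤ (m / r + 1) * r := Nat.mul_le_mul_right r h2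
      _ = m / r * r + r := by ring
      _ ≤ m + r := by have := Nat.div_mul_le_self m r; omega
  have h3' : (h : ℝ) * r ≤ m + r := by exact_mod_cast h3
  refine ⟨by unfold samplePoint; positivity, ?_⟩
  -- The shift by 1/2 keeps the point for h = ⌊m/r⌋ + 1 strictly below π/r even when `r` divides
  -- `m`.
  rw [samplePoint, div_lt_div_iff₀ (by positivity) hr']
  nlinarith [pi_pos]

theorem samplePoint_strictMono (r m : ℕ) : StrictMono (samplePoint r m) := fun h h' hh => by
  have : (h : ℝ) < h' := by exact_mod_cast hh
  have := pi_pos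
  unfold samplePoint
  gcongr

theorem sign_hVal_samplePoint (hn : 1 ≤ n) (hr : 1 ≤ r) (hnr : 1 < max n r) (ha : 0 < a)
    (hτ : ∀ k, 0 < τ k) {m h : ℕ} (h1 : 1 ≤ h) (h2 : h ≤ m / r + 1) :
    0 < (-1) ^ h * hVal a τ r m (samplePoint r m h) := by
  refine sign_hVal hn hr hnr ha hτ (samplePoint_mem hr h1 h2) (κ := 1 / 2) (by norm_num)
    (by norm_num) (Or.inl (by norm_num)) ?_
  have : (m : ℝ) + r + 1 / 2 ≠ 0 := by positivity
  rw [samplePoint]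
  field_simp

/-- All complex zeros of `H_m` are values `z(θ)`, with `θ` to the left of the last sample point. -/
theorem exists_of_aeval_genPoly_eq_zero (hn : 1 ≤ n) (hr : 1 ≤ r) (hnr : 1 < max n r) (ha : 0 < a)
    (hτ : ∀ k, 0 < τ k) {m : ℕ} {w : ℂ} (hw : aeval w (genPoly a τ r m) = 0) :
    ∃ θ ∈ Set.Ioo 0 (π / r), θ < samplePoint r m (m / r + 1) ∧ w = zReal a τ r θ := by
  have hmono := samplePoint_strictMono r m
  have hex : ∀ h, 1 ≤ h ∧ h ≤ m / r → ∃ c ∈ Set.Ioo (samplePoint r m h) (samplePoint r m (h + 1)),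
      hVal a τ r m c = 0 := fun h ⟨h1, h2⟩ => by
    refine exists_zero_Ioo (hmono (Nat.lt_succ_self h))
      ((continuousOn_hVal hn hr hnr hτ m).mono (Set.Icc_subset_Ioo
        (samplePoint_mem hr h1 (by omega)).1 (samplePoint_mem hr (by omega) (by omega)).2)) ?_
    have e1 := sign_hVal_samplePoint hn hr hnr ha hτ h1 (m := m) (by omega)
    have e2 := sign_hVal_samplePoint hn hr hnr ha hτ (m := m) (h := h + 1) (by omega) (by omega)
    have e3 := mul_pos e1 e2
    have e4 : ((-1 : ℝ) ^ h) * (-1) ^ h = 1 := by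
      rcases neg_one_pow_eq_or ℝ h with e | e <;> rw [e] <;> norm_num
    rw [pow_succ] at e3
    have e5 : (-1) ^ h * hVal a τ r m (samplePoint r m h) *
        ((-1) ^ h * -1 * hVal a τ r m (samplePoint r m (h + 1))) =
        -(hVal a τ r m (samplePoint r m h) * hVal a τ r m (samplePoint r m (h + 1))) := by
      linear_combination (-(hVal a τ r m (samplePoint r m h) *
        hVal a τ r m (samplePoint r m (h + 1)))) * e4
    linarith
  choose! c hc hc0 using hex
  have hcI : ∀ h, 1 ≤ h ∧ h ≤ m / r → c h ∈ Set.Ioo 0 (π / r) := fun h hh =>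
    ⟨(samplePoint_mem hr hh.1 (by omega)).1.trans (hc h hh).1,
      (hc h hh).2.trans (samplePoint_mem hr (by omega) (by omega)).2⟩
  have hH0 : genPoly a τ r m ≠ 0 := fun h => by
    have := sign_hVal_samplePoint hn hr hnr ha hτ (m := m) (h := 1) le_rfl (Nat.le_add_left 1 _)
    simp [hVal, h] at this
  set S : Finset ℂ := (Finset.Icc 1 (m / r)).image fun h => (zReal a τ r (c h) : ℂ) with hS
  have hcard : S.card = m / r := by
    rw [hS, Finset.card_image_of_injOn]
    · simp
    · intro h hh h' hh' e
      rw [Finset.mem_coe, Finset.mem_Icc] at hh hh'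
      have e1 := injOn_zReal hn hr hnr ha hτ (hcI h hh) (hcI h' hh') (Complex.ofReal_injective e)
      rcases lt_trichotomy h h' with hlt | heq | hgt
      · have := hmono.monotone (show h + 1 ≤ h' from hlt)
        linarith [(hc h hh).2, (hc h' hh').1]
      · exact heq
      · have := hmono.monotone (show h' + 1 ≤ h from hgt)
        linarith [(hc h hh).1, (hc h' hh').2]
  by_cases hwS : w ∈ S
  · obtain ⟨h, hh, rfl⟩ := Finset.mem_image.1 hwS
    rw [Finset.mem_Icc] at hh
    exact ⟨c h, hcI h hh, (hc h hh).2.trans_le (hmono.monotone (by omega)), rfl⟩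
  -- A further zero would give H_m at least ⌊m/r⌋ + 1 distinct zeros, more than its degree allows.
  · exfalso
    have hsub : insert w S ⊆ ((genPoly a τ r m).aroots ℂ).toFinset := by
      intro v hv
      rw [Multiset.mem_toFinset, mem_aroots]
      refine ⟨hH0, ?_⟩
      rcases Finset.mem_insert.1 hv with rfl | hv
      · exact hw
      · obtain ⟨h, hh, rfl⟩ := Finset.mem_image.1 hv
        rw [Finset.mem_Icc] at hh
        have e := (hVal_eq_zero_iff hn hr hnr ha hτ (hcI h hh) m).1 (hc0 h hh)
        rw [← Complex.coe_algebraMap, aeval_algebraMap_apply, coe_aeval_eq_eval, e, map_zero]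
    have h1 := Finset.card_le_card hsub
    rw [Finset.card_insert_of_notMem hwS, hcard] at h1
    have h2 := Multiset.toFinset_card_le ((genPoly a τ r m).aroots ℂ)
    have h3 := (card_roots' ((genPoly a τ r m).map (algebraMap ℝ ℂ))).trans natDegree_map_le
    have h4 := natDegree_genPoly_le ha hτ hr m
    rw [← aroots_def] at h3
    omega

/-- All zeros of H_m are already accounted for to the left of the last sample point, so by
injectivity of z(θ) the sign found there persists up to π/r. -/
theorem sign_hVal_of_samplePoint_lt (hn : 1 ≤ n) (hr : 1 ≤ r) (hnr : 1 < max n r) (ha : 0 < a)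
    (hτ : ∀ k, 0 < τ k) {m : ℕ} (h1 : samplePoint r m (m / r + 1) < θ) (h2 : θ < π / r) :
    0 < (-1) ^ (m / r + 1) * hVal a τ r m θ := by
  have hx := samplePoint_mem hr (m := m) (h := m / r + 1) (Nat.le_add_left 1 _) le_rfl
  have hsign := sign_hVal_samplePoint hn hr hnr ha hτ (m := m) (h := m / r + 1) (Nat.le_add_left 1 _) le_rfl
  have hne : ∀ c, samplePoint r m (m / r + 1) < c → c < π / r → hVal a τ r m c ≠ 0 := by
    intro c hc1 hc2 hc
    have hcI : c ∈ Set.Ioo 0 (π / r) := ⟨hx.1.trans hc1, hc2⟩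
    have e := (hVal_eq_zero_iff hn hr hnr ha hτ hcI m).1 hc
    obtain ⟨c', hc', hlt, hz⟩ := exists_of_aeval_genPoly_eq_zero hn hr hnr ha hτ
      (w := zReal a τ r c) (m := m) (by
        rw [← Complex.coe_algebraMap, aeval_algebraMap_apply, coe_aeval_eq_eval, e, map_zero])
    have := injOn_zReal hn hr hnr ha hτ hcI hc' (Complex.ofReal_injective hz)
    linarith
  by_contra! hcon
  have hneg : (-1) ^ (m / r + 1) * hVal a τ r m θ < 0 :=
    lt_of_le_of_ne hcon (mul_ne_zero (pow_ne_zero _ (by norm_num)) (hne θ h1 h2))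
  obtain ⟨c, hc, hc0⟩ := exists_zero_Ioo (f := fun x => (-1) ^ (m / r + 1) * hVal a τ r m x) h1
    (continuousOn_const.mul ((continuousOn_hVal hn hr hnr hτ m).mono
      (Set.Icc_subset_Ioo hx.1 h2))) (mul_neg_of_pos_of_neg hsign hneg)
  exact mul_ne_zero (pow_ne_zero _ (by norm_num)) (hne c hc.1 (hc.2.trans h2)) hc0

end

theorem mainTheorem2 (n r : ℕ) (hn : 1 ≤ n) (hr : 1 ≤ r) (hnr : 1 < max n r)
    (a : ℝ) (ha : 0 < a) (τ : Fin n → ℝ) (hτ : ∀ k, 0 < τ k) :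
    -- `z(θ)` is real, and `H(θ)` is the real continuous function attached to `H_m(z(θ))`
    (∀ θ ∈ Set.Ioo 0 (π / r), (zFun a τ r θ).im = 0) ∧
    (∀ m : ℕ,
      ContinuousOn (hFun τ r m) (Set.Ioo 0 (π / r)) ∧
      (∀ θ ∈ Set.Ioo 0 (π / r), ((qPoly τ r θ).aroots ℂ).Nodup →
        (hFun τ r m θ : ℂ) = hSum τ r m θ) ∧
      (∀ θ ∈ Set.Ioo 0 (π / r),
        hFun τ r m θ = 0 ↔ aeval (zFun a τ r θ) (genPoly a τ r m) = 0)) ∧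
    -- the signs at the points `hπ / (m + r)`
    ((n, r) ≠ (2, 1) → ∃ M : ℕ, ∀ m ≥ M, ∀ h : ℕ, 1 ≤ h → h ≤ m / r →
      Real.sign (hFun τ r m (h * π / (m + r))) = (-1) ^ h) ∧
    -- the sign as `θ → π / r` from below
    (∃ M : ℕ, ∀ m ≥ M, ∀ᶠ θ in 𝓝[<] (π / r),
      Real.sign (hFun τ r m θ) = (-1) ^ (m / r + 1)) ∧
    -- the degree bound and the reality of all zeros
    (∀ m : ℕ, (genPoly a τ r m).natDegree ≤ m / r) ∧
    (∃ M : ℕ, ∀ m ≥ M, ∀ w : ℂ, aeval w (genPoly a τ r m) = 0 → w.im = 0) := by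
  -- All thresholds are 0, since the sign argument holds for every `m`. In the excluded case (2, 1),
  -- H_m(z(θ)) is a positive multiple of sin((m + 1)θ) / sin θ, which vanishes at the points hπ/(m +
  -- 1).
  refine ⟨fun θ hθ => ?_, fun m => ⟨?_, fun θ hθ hnd => ?_, fun θ hθ => ?_⟩, fun hne =>
    ⟨0, fun m _ h h1 h2 => ?_⟩, ⟨0, fun m _ => ?_⟩, natDegree_genPoly_le ha hτ hr,
    ⟨0, fun m _ w hw => ?_⟩⟩
  · rw [zFun_eq hn hr hnr hτ hθ, Complex.ofReal_im]
  · exact (continuousOn_hVal hn hr hnr hτ m).congr fun θ hθ => hFun_eq hn hr hnr ha hτ hθ m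
  · rw [hFun_eq hn hr hnr ha hτ hθ, hSum_eq hn hr hnr ha hτ hθ hnd]
  · rw [hFun_eq hn hr hnr ha hτ hθ, hVal_eq_zero_iff hn hr hnr ha hτ hθ,
      zFun_eq hn hr hnr hτ hθ, ← Complex.coe_algebraMap, aeval_algebraMap_apply, coe_aeval_eq_eval]
    simp
  · have hr' : (0 : ℝ) < r := by exact_mod_cast hr
    have h1' : (0 : ℝ) < h := by exact_mod_cast h1
    have hhr : h * r ≤ m := (Nat.mul_le_mul_right r h2).trans (Nat.div_mul_le_self m r)
    have hhr' : (h : ℝ) * r ≤ m := by exact_mod_cast hhr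
    have hmem : h * π / (m + r) ∈ Set.Ioo 0 (π / r) := by
      refine ⟨by positivity, ?_⟩
      rw [div_lt_div_iff₀ (by positivity) hr']
      nlinarith [pi_pos]
    rw [hFun_eq hn hr hnr ha hτ hmem]
    refine sign_eq_neg_one_pow (sign_hVal hn hr hnr ha hτ hmem (κ := 0) le_rfl one_pos
      (Or.inr hne) ?_)
    rw [add_zero]
    field_simp
  · have hx := samplePoint_mem hr (m := m) (h := m / r + 1) (Nat.le_add_left 1 _) le_rfl
    filter_upwards [Ioo_mem_nhdsLT hx.2] with θ hθ
    rw [hFun_eq hn hr hnr ha hτ ⟨hx.1.trans hθ.1, hθ.2⟩]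
    exact sign_eq_neg_one_pow (sign_hVal_of_samplePoint_lt hn hr hnr ha hτ hθ.1 hθ.2)
  · obtain ⟨θ, _, _, rfl⟩ := exists_of_aeval_genPoly_eq_zero hn hr hnr ha hτ hw
    exact Complex.ofReal_im _
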